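/- All graphs are finite, simple and undirected. For a graph $G=(V,E)$, a vertex $v\in V$, a set $T\subseteq V$ and an integer $k\ge 0$, say that $v$ is $k$-linked to $T$ if there are $k$ distinct paths in $G$, each connecting $v$ to a vertex of $T$, any two of which have only the vertex $v$ in common (if $v\in T$, the path of length zero at $v$ may be one of them). Let $r:V\to\{0,1,2,\dots\}$ and $F\subseteq V$. A set $S\subseteq V$ is a vector connectivity set for $(G,r)$ if every $v\in V\setminus S$ is $r(v)$-linked to $S$, and a vector connectivity set for $(G,F,r)$ if every $v\in V\setminus S$ is $r(v)$-linked to $S\cup F$. The problem VecCon asks, given $(G,r)$, for a vector connectivity set for $(G,r)$ of minimum size; the problem FreeVecCon asks, given $(G,F,r)$, for a vector connectivity set for $(G,F,r)$ of minimum size. A graph is biconnected if it is connected and has no cut vertex, a block of $G$ is a maximal biconnected subgraph of $G$, and $G$ is a block graph if every block of $G$ is complete. **Theorem.** VecCon and FreeVecCon are solvable in polynomial time on block graphs. That is, for each of the two problems there are an algorithm (a program of a random access machine whose arithmetic operations are addition and truncated subtraction, every operation costing one step) and a polynomial $q$ such that, on every instance in which $G$ is a block graph, the algorithm halts after at most $q(L)$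 steps and outputs a vector connectivity set of minimum size, where $L$ is the length of the instance in bits ($G$ given by its adjacency matrix, $F$ by its characteristic vector, the requirements $r(v)$ in binary). -/

import Mathlib

/-! ### Random access machines with a step count

Memory consists of registers and of unbounded arrays, both holding natural numbers. The only
arithmetic is addition and truncated subtraction, so that numbers gain at most a constant number
of bits per step and polynomial time is the same as for Turing machines. A program mentions only
finitely many registers and arrays and is fixed before the input is given. -/

namespace RAM

/-- The memory: register `x` holds `reg x`, position `i` of array `a` holds `arr a i`. -/
@[ext]
structure Store where
  reg : ℕ → ℕ
  arr : ℕ → ℕ → ℕ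

/-- Arithmetic expressions; `read a e` is the entry of array `a` at position `e`. -/
inductive AExp where
  | const (c : ℕ)
  | reg (x : ℕ)
  | read (a : ℕ) (e : AExp)
  | add (e f : AExp)
  | sub (e f : AExp)

/-- The value of an expression. -/
def AExp.eval (s : Store) : AExp → ℕ
  | .const c => c
  | .reg x => s.reg x
  | .read a e => s.arr a (e.eval s)
  | .add e f => e.eval s + f.eval s
  | .sub e f => e.eval s - f.eval s

/-- The cost of evaluating an expression: one step for every operation in it. -/
def AExp.cost : AExp → ℕ
  | .const _ => 1
  | .reg _ => 1
  | .read _ e => e.cost + 1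
  | .add e f => e.cost + f.cost + 1
  | .sub e f => e.cost + f.cost + 1

/-- Programs. In `ite e p q` and `loop e p` the test is `e ≠ 0`. -/
inductive Prog where
  | skip
  | assign (x : ℕ) (e : AExp)
  | write (a : ℕ) (i e : AExp)
  | seq (p q : Prog)
  | ite (e : AExp) (p q : Prog)
  | loop (e : AExp) (p : Prog)

/-- `Runs p s s' t`: started in memory `s`, the program `p` halts after `t` steps in
memory `s'`. -/
inductive Runs : Prog → Store → Store → ℕ → Prop where
  | skip (s : Store) : Runs .skip s s 1
  | assign (s : Store) (x : ℕ) (e : AExp) :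
      Runs (.assign x e) s { s with reg := Function.update s.reg x (e.eval s) } (e.cost + 1)
  | write (s : Store) (a : ℕ) (i e : AExp) :
      Runs (.write a i e) s
        { s with
          arr := Function.update s.arr a (Function.update (s.arr a) (i.eval s) (e.eval s)) }
        (i.cost + e.cost + 1)
  | seq {p q : Prog} {s s' s'' : Store} {t t' : ℕ} :
      Runs p s s' t → Runs q s' s'' t' → Runs (.seq p q) s s'' (t + t' + 1)
  | ite_true {e : AExp} {p q : Prog} {s s' : Store} {t : ℕ} :
      e.eval s ≠ 0 → Runs p s s' t → Runs (.ite e p q) s s' (e.cost + t + 1)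
  | ite_false {e : AExp} {p q : Prog} {s s' : Store} {t : ℕ} :
      e.eval s = 0 → Runs q s s' t → Runs (.ite e p q) s s' (e.cost + t + 1)
  | loop_true {e : AExp} {p : Prog} {s s' s'' : Store} {t t' : ℕ} :
      e.eval s ≠ 0 → Runs p s s' t → Runs (.loop e p) s' s'' t' →
        Runs (.loop e p) s s'' (e.cost + t + t' + 1)
  | loop_false {e : AExp} {p : Prog} {s : Store} :
      e.eval s = 0 → Runs (.loop e p) s s (e.cost + 1)

/-- Runs are deterministic: the final memory and the number of steps are determined. -/
theorem Runs.deterministic {p : Prog} {s s₁ s₂ : Store} {t₁ t₂ : ℕ}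
    (h₁ : Runs p s s₁ t₁) (h₂ : Runs p s s₂ t₂) : s₁ = s₂ ∧ t₁ = t₂ := by
  induction h₁ generalizing s₂ t₂ with
  | skip | assign | write => cases h₂; exact ⟨rfl, rfl⟩
  | seq _ _ ih ih' =>
    cases h₂ with
    | seq a b =>
      obtain ⟨rfl, rfl⟩ := ih a
      obtain ⟨rfl, rfl⟩ := ih' b
      exact ⟨rfl, rfl⟩
  | ite_true he _ ih =>
    cases h₂ with
    | ite_true _ a => obtain ⟨rfl, rfl⟩ := ih a; exact ⟨rfl, rfl⟩
    | ite_false h _ => exact absurd h he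
  | ite_false he _ ih =>
    cases h₂ with
    | ite_false _ a => obtain ⟨rfl, rfl⟩ := ih a; exact ⟨rfl, rfl⟩
    | ite_true h _ => exact absurd he h
  | loop_true he _ _ ih ih' =>
    cases h₂ with
    | loop_true _ a b =>
      obtain ⟨rfl, rfl⟩ := ih a
      obtain ⟨rfl, rfl⟩ := ih' b
      exact ⟨rfl, rfl⟩
    | loop_false h => exact absurd h he
  | loop_false he =>
    cases h₂ with
    | loop_false _ => exact ⟨rfl, rfl⟩
    | loop_true h _ _ => exact absurd he h

end RAM

/-! ### Blocks, fans and vector connectivity sets -/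

namespace VectorConnectivity

variable {V : Type*}

/-- `v` is a cut vertex of `G`: deleting `v` separates two vertices of one component of `G`. -/
def IsCutVertex (G : SimpleGraph V) (v : V) : Prop :=
  ∃ u w : ({v}ᶜ : Set V), G.Reachable u w ∧ ¬ (G.induce ({v}ᶜ : Set V)).Reachable u w

/-- A graph is biconnected if it is connected and has no cut vertex. -/
def IsBiconnected (G : SimpleGraph V) : Prop :=
  G.Connected ∧ ∀ v, ¬ IsCutVertex G v

/-- A block of `G` is a maximal biconnected subgraph of `G`. -/
def IsBlock {G : SimpleGraph V} (B : G.Subgraph) : Prop :=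
  Maximal (fun H : G.Subgraph => IsBiconnected H.coe) B

/-- A block graph is a graph (not necessarily connected) every block of which is complete. -/
def IsBlockGraph (G : SimpleGraph V) : Prop :=
  ∀ B : G.Subgraph, IsBlock B → B.coe = ⊤

/-- `v` is `k`-linked to `T`: there is a `v`–`T` fan of order `k`, that is, `k` distinct paths from
`v` to vertices of `T` of which any two have only `v` in common. Two such paths with the same
end are both the path of length zero, so distinctness of the paths is distinctness of their ends;
if `v ∈ T`, then the path of length zero may serve as one (and only one) of the paths. -/
def IsLinked (G : SimpleGraph V) (v : V) (T : Set V) (k : ℕ) : Prop :=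
  ∃ (e : Fin k → V) (P : ∀ i, G.Path v (e i)),
    Function.Injective e ∧ (∀ i, e i ∈ T) ∧
      ∀ i j, i ≠ j → ∀ w, w ∈ (P i).1.support → w ∈ (P j).1.support → w = v

/-- `S` is a vector connectivity set for `(G, r)`. -/
def IsVCSet (G : SimpleGraph V) (r : V → ℕ) (S : Finset V) : Prop :=
  ∀ v, v ∉ S → IsLinked G v (S : Set V) (r v)

/-- `S` is a vector connectivity set for `(G, F, r)`, where `F` is the set of free vertices. -/
def IsFreeVCSet (G : SimpleGraph V) (F : Finset V) (r : V → ℕ) (S : Finset V) : Prop :=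
  ∀ v, v ∉ S → IsLinked G v ((S : Set V) ∪ (F : Set V)) (r v)

/-- `S` is a solution of the VecCon instance `(G, r)`: a vector connectivity set of minimum
size. -/
def SolvesVecCon (G : SimpleGraph V) (r : V → ℕ) (S : Finset V) : Prop :=
  IsVCSet G r S ∧ ∀ T : Finset V, IsVCSet G r T → S.card ≤ T.card

/-- `S` is a solution of the FreeVecCon instance `(G, F, r)`. -/
def SolvesFreeVecCon (G : SimpleGraph V) (F : Finset V) (r : V → ℕ) (S : Finset V) : Prop :=
  IsFreeVCSet G F r S ∧ ∀ T : Finset V, IsFreeVCSet G F r T → S.card ≤ T.card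

/-! ### Instances as machine inputs

The vertices are `0, …, n - 1`. -/

open Classical in
/-- The initial memory for the VecCon instance `(G, r)`: register `0` holds the number `n` of
vertices, array `0` the adjacency matrix of `G` row by row, array `1` the requirements; the rest
of the memory is zero. -/
noncomputable def vecConInput {n : ℕ} (G : SimpleGraph (Fin n)) (r : Fin n → ℕ) : RAM.Store where
  reg x := if x = 0 then n else 0
  arr a i :=
    if a = 0 then (if ∃ u v : Fin n, i = (u : ℕ) * n + (v : ℕ) ∧ G.Adj u v then 1 else 0)
    else if a = 1 then (if h : i < n then r ⟨i, h⟩ else 0)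
    else 0

open Classical in
/-- The initial memory for the FreeVecCon instance `(G, F, r)`: as for `(G, r)`, and array `2`
holds the characteristic vector of `F`. -/
noncomputable def freeVecConInput {n : ℕ} (G : SimpleGraph (Fin n)) (F : Finset (Fin n))
    (r : Fin n → ℕ) : RAM.Store where
  reg x := if x = 0 then n else 0
  arr a i :=
    if a = 0 then (if ∃ u v : Fin n, i = (u : ℕ) * n + (v : ℕ) ∧ G.Adj u v then 1 else 0)
    else if a = 1 then (if h : i < n then r ⟨i, h⟩ else 0)
    else if a = 2 then (if ∃ v ∈ F, i = (v : ℕ) then 1 else 0)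
    else 0

/-- The length in bits of an instance on `n` vertices: the adjacency matrix has `n ^ 2` bits, the
characteristic vector of the free set has `n` bits, and the requirements are written in binary.
(The `n` bits for the free set do not matter up to a polynomial in an instance without one.) -/
def instanceLength {n : ℕ} (r : Fin n → ℕ) : ℕ :=
  n ^ 2 + n + ∑ v, Nat.size (r v)

/-- The vertex set that the machine outputs: its characteristic vector is in array `3`. -/
def outputSet (n : ℕ) (s : RAM.Store) : Finset (Fin n) :=
  Finset.univ.filter fun v => s.arr 3 v ≠ 0

end VectorConnectivity

/-! In a block graph the fans at `v` are determined by the first steps of shortest paths: `v` is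
`k`-linked to `T` if and only if at least `k` vertices are the first step of a shortest path from
`v` to `T`, where `v` itself counts if it is in `T`.

Consider a component and fix a vertex `ρ` of it that the solution shall contain. Treat the blocks
in the order of decreasing distance from `ρ`, leaving the vertex `p` of the block closest to `ρ` to
the blocks above. A vertex is hit if a shortest path from `ρ` to a chosen or free vertex passes
through it. Once the choice beyond the block is made, a choice in the block is feasible or not
depending only on the number `h` of its vertices that are hit. So it is easy to find a feasible
choice of minimum size, and among these one for which `h` is maximum. It is optimal by an
exchange argument: the part of any solution in the block can be replaced by this choice, together
with `p` if the choice is smaller than the part that it replaces. Vertices of other blocks only see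
whether some vertex of this block is hit, and they see `p` just as well.

The best solution over all roots `ρ`, and the empty set if it is feasible, is a minimum solution of
the component. The algorithm is written in a small language of vectors and matrices indexed by
vertices, all of whose programs compile to machine programs of polynomial running time. -/

/-! ### Running programs with a time bound -/

namespace RAM

/-- Total correctness with a time bound: started in `s`, the program `p` halts within `T` steps in
a memory satisfying `Q`. -/
def Does (p : Prog) (s : Store) (T : ℕ) (Q : Store → Prop) : Prop :=
  ∃ s' t, Runs p s s' t ∧ t ≤ T ∧ Q s'

/-- The memory `s` with register `x` set to `v`. -/
def Store.setReg (s : Store) (x v : ℕ) : Store :=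
  { s with reg := Function.update s.reg x v }

/-- The memory `s` with position `i` of array `a` set to `v`. -/
def Store.setArr (s : Store) (a i v : ℕ) : Store :=
  { s with arr := Function.update s.arr a (Function.update (s.arr a) i v) }

namespace Store

variable (s : Store)

@[simp]
lemma setReg_arr (x v : ℕ) : (s.setReg x v).arr = s.arr := rfl

@[simp]
lemma setArr_reg (a i v : ℕ) : (s.setArr a i v).reg = s.reg := rfl

@[simp]
lemma setReg_reg_self (x v : ℕ) : (s.setReg x v).reg x = v := by
  simp [setReg]

lemma setReg_reg_of_ne {x y : ℕ} (v : ℕ) (h : y ≠ x) : (s.setReg x v).reg y = s.reg y := by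
  simp [setReg, h]

lemma setReg_reg (x v y : ℕ) : (s.setReg x v).reg y = if y = x then v else s.reg y := by
  simp [setReg, Function.update_apply]

lemma setArr_arr (a i v b j : ℕ) :
    (s.setArr a i v).arr b j = if b = a ∧ j = i then v else s.arr b j := by
  by_cases h : b = a
  · subst h; simp [setArr, Function.update_apply]
  · simp [setArr, h]

end Store

lemma Does.mono {p : Prog} {s : Store} {T T' : ℕ} {Q Q' : Store → Prop} (h : Does p s T Q)
    (hT : T ≤ T') (hQ : ∀ s', Q s' → Q' s') : Does p s T' Q' := by
  obtain ⟨s', t, h1, h2, h3⟩ := h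
  exact ⟨s', t, h1, h2.trans hT, hQ _ h3⟩

lemma does_skip {s : Store} {Q : Store → Prop} (h : Q s) : Does .skip s 1 Q :=
  ⟨_, _, .skip s, le_rfl, h⟩

lemma does_assign {x : ℕ} {e : AExp} {s : Store} {Q : Store → Prop}
    (h : Q (s.setReg x (e.eval s))) : Does (.assign x e) s (e.cost + 1) Q :=
  ⟨_, _, .assign s x e, le_rfl, h⟩

lemma does_write {a : ℕ} {i e : AExp} {s : Store} {Q : Store → Prop}
    (h : Q (s.setArr a (i.eval s) (e.eval s))) :
    Does (.write a i e) s (i.cost + e.cost + 1) Q :=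
  ⟨_, _, .write s a i e, le_rfl, h⟩

lemma Does.seq {p q : Prog} {s : Store} {T T' : ℕ} {Q R : Store → Prop} (h : Does p s T Q)
    (h' : ∀ s', Q s' → Does q s' T' R) : Does (.seq p q) s (T + T' + 1) R := by
  obtain ⟨s', t, h1, h2, h3⟩ := h
  obtain ⟨s'', t', h4, h5, h6⟩ := h' s' h3
  exact ⟨s'', _, .seq h1 h4, by omega, h6⟩

lemma does_ite {e : AExp} {p q : Prog} {s : Store} {T T' : ℕ} {Q : Store → Prop}
    (h : e.eval s ≠ 0 → Does p s T Q) (h' : e.eval s = 0 → Does q s T' Q) :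
    Does (.ite e p q) s (e.cost + T + T' + 1) Q := by
  by_cases he : e.eval s = 0
  · obtain ⟨s', t, h1, h2, h3⟩ := h' he
    exact ⟨s', _, .ite_false he h1, by omega, h3⟩
  · obtain ⟨s', t, h1, h2, h3⟩ := h he
    exact ⟨s', _, .ite_true he h1, by omega, h3⟩

/-- Run `p` with register `c` counting from `0` to one less than the content of register `0`. -/
def forReg (c : ℕ) (p : Prog) : Prog :=
  .seq (.assign c (.const 0))
    (.loop (.sub (.reg 0) (.reg c)) (.seq p (.assign c (.add (.reg c) (.const 1)))))

lemma does_forReg {c n T : ℕ} {p : Prog} {s : Store} (I : ℕ → Store → Prop)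
    (hI : ∀ i s, I i s → s.reg 0 = n ∧ s.reg c = i)
    (hbody : ∀ i < n, ∀ s, I i s →
      Does p s T fun s' => s'.reg c = i ∧ I (i + 1) (s'.setReg c (i + 1)))
    (h0 : I 0 (s.setReg c 0)) : Does (forReg c p) s (n * (T + 9) + 7) (I n) := by
  have hloop : ∀ m i s, i + m = n → I i s →
      Does (.loop (.sub (.reg 0) (.reg c)) (.seq p (.assign c (.add (.reg c) (.const 1))))) s
        (m * (T + 9) + 4) (I n) := by
    intro m
    induction m with
    | zero =>
      intro i s him hs
      obtain rfl : i = n := by omega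
      obtain ⟨hn, hi⟩ := hI _ _ hs
      exact ⟨s, _, .loop_false (by simp [AExp.eval, hn, hi]), by simp [AExp.cost], hs⟩
    | succ m ih =>
      intro i s him hs
      obtain ⟨hn, hi⟩ := hI _ _ hs
      obtain ⟨s', t, hr, ht, hs'⟩ : Does (.seq p (.assign c (.add (.reg c) (.const 1)))) s
          (T + (3 + 1) + 1) (I (i + 1)) := by
        refine (hbody i (by omega) s hs).seq fun s' hs' => does_assign ?_
        simpa [AExp.eval, hs'.1] using hs'.2
      obtain ⟨s'', t', hr', ht', hs''⟩ := ih (i + 1) s' (by omega) hs'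
      refine ⟨s'', _, .loop_true (by simp [AExp.eval, hn, hi]; omega) hr hr', ?_, hs''⟩
      simp only [AExp.cost]
      rw [Nat.succ_mul]
      omega
  have hinit : Does (.assign c (.const 0)) s 2 (I 0) := does_assign (by simpa [AExp.eval] using h0)
  exact (hinit.seq fun s' hs' => hloop n 0 s' (by omega) hs').mono (by omega) fun _ h => h

/-! ### Code over a memory of vectors and matrices -/

/-- Vectors and matrices indexed by `Fin n`. -/
structure Mem (n : ℕ) where
  one : ℕ → Fin n → ℕ
  two : ℕ → Fin n → Fin n → ℕ

/-- The state of a computation: work registers, a scratch matrix, and the memory proper. -/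
structure State (n : ℕ) where
  acc : ℕ → ℕ
  tmp : Fin n → Fin n → ℕ
  mem : Mem n

/-- Arithmetic terms over work registers `acc k`, index variables `idx x` with values in `Fin n`,
and the entries of vectors and matrices at such variables. -/
inductive Term where
  | num (c : ℕ)
  | idx (x : ℕ)
  | acc (k : ℕ)
  | tmp (x y : ℕ)
  | get1 (a x : ℕ)
  | get2 (a x y : ℕ)
  | add (t u : Term)
  | sub (t u : Term)

/-- The value of a term in an environment. -/
def Term.eval {n : ℕ} (ρ : ℕ → Fin n) (σ : State n) : Term → ℕ
  | .num c => c
  | .idx x => ρ x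
  | .acc k => σ.acc k
  | .tmp x y => σ.tmp (ρ x) (ρ y)
  | .get1 a x => σ.mem.one a (ρ x)
  | .get2 a x y => σ.mem.two a (ρ x) (ρ y)
  | .add t u => t.eval ρ σ + u.eval ρ σ
  | .sub t u => t.eval ρ σ - u.eval ρ σ

/-- Code over states. The stores write the work register `acc k`, the test of `ite k c d` is
`acc k ≠ 0`, and `loop x c` runs `c` with the variable `x` ranging over `Fin n`, so that all code
takes polynomial time. -/
inductive Code where
  | set (k : ℕ) (t : Term)
  | storeTmp (x y k : ℕ)
  | store1 (a x k : ℕ)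
  | store2 (a x y k : ℕ)
  | seq (c d : Code)
  | ite (k : ℕ) (c d : Code)
  | loop (x : ℕ) (c : Code)

/-- The effect of code in an environment. -/
def Code.exec {n : ℕ} : Code → (ℕ → Fin n) → State n → State n
  | .set k t, ρ, σ => { σ with acc := Function.update σ.acc k (t.eval ρ σ) }
  | .storeTmp x y k, ρ, σ =>
    { σ with tmp := Function.update σ.tmp (ρ x) (Function.update (σ.tmp (ρ x)) (ρ y) (σ.acc k)) }
  | .store1 a x k, ρ, σ =>
    { σ with mem.one :=
        Function.update σ.mem.one a (Function.update (σ.mem.one a) (ρ x) (σ.acc k)) }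
  | .store2 a x y k, ρ, σ =>
    { σ with mem.two := Function.update σ.mem.two a (Function.update (σ.mem.two a) (ρ x)
        (Function.update (σ.mem.two a (ρ x)) (ρ y) (σ.acc k))) }
  | .seq c d, ρ, σ => d.exec ρ (c.exec ρ σ)
  | .ite k c d, ρ, σ => if σ.acc k ≠ 0 then c.exec ρ σ else d.exec ρ σ
  | .loop x c, ρ, σ => Nat.fold n (fun i hi τ => c.exec (Function.update ρ x ⟨i, hi⟩) τ) σ

/-! ### Compilation of code -/

/-- The store `s` represents the state `σ` and the environment `ρ`. The values of `ρ` are not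
required to be less than `n`, because the counter of a loop reaches `n`. Array `6` is a table of
the multiples of `n`, since there is no multiplication. -/
structure Rep (n : ℕ) (ρ : ℕ → ℕ) (σ : State n) (s : Store) : Prop where
  size : s.reg 0 = n
  var : ∀ x, s.reg (3 * x + 1) = ρ x
  acc : ∀ k, s.reg (3 * k + 2) = σ.acc k
  table : ∀ i : Fin n, s.arr 6 i = i * n
  tmp : ∀ i j : Fin n, s.arr 2 (i * n + j) = σ.tmp i j
  one : ∀ a (i : Fin n), s.arr (2 * a + 1) i = σ.mem.one a i
  two : ∀ a (i j : Fin n), s.arr (4 * a) (i * n + j) = σ.mem.two a i j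

/-- The position `x * n + y` of the entry of a matrix at the variables `x` and `y`. -/
def entry (x y : ℕ) : AExp :=
  .add (.read 6 (.reg (3 * x + 1))) (.reg (3 * y + 1))

/-- The expression of the machine for a term. -/
def Term.comp : Term → AExp
  | .num c => .const c
  | .idx x => .reg (3 * x + 1)
  | .acc k => .reg (3 * k + 2)
  | .tmp x y => .read 2 (entry x y)
  | .get1 a x => .read (2 * a + 1) (.reg (3 * x + 1))
  | .get2 a x y => .read (4 * a) (entry x y)
  | .add t u => .add t.comp u.comp
  | .sub t u => .sub t.comp u.comp

/-- The program of the machine for code at loop depth `d`. A loop at depth `d` keeps the old value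
of its variable in register `3 * d + 3`. -/
def Code.comp : Code → ℕ → Prog
  | .set k t, _ => .assign (3 * k + 2) t.comp
  | .storeTmp x y k, _ => .write 2 (entry x y) (.reg (3 * k + 2))
  | .store1 a x k, _ => .write (2 * a + 1) (.reg (3 * x + 1)) (.reg (3 * k + 2))
  | .store2 a x y k, _ => .write (4 * a) (entry x y) (.reg (3 * k + 2))
  | .seq c e, d => .seq (c.comp d) (e.comp d)
  | .ite k c e, d => .ite (.reg (3 * k + 2)) (c.comp d) (e.comp d)
  | .loop x c, d => .seq (.assign (3 * d + 3) (.reg (3 * x + 1)))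
      (.seq (forReg (3 * x + 1) (c.comp (d + 1)))
        (.assign (3 * x + 1) (.reg (3 * d + 3))))

lemma row_position {n : ℕ} {i i' j j' : Fin n} :
    (i : ℕ) * n + j = i' * n + j' ↔ i = i' ∧ j = j' := by
  refine ⟨fun h => ?_, fun h => by rw [h.1, h.2]⟩
  have hdiv : ∀ k l : Fin n, ((k : ℕ) * n + l) / n = k := fun k l => by
    rw [Nat.mul_comm, Nat.mul_add_div l.pos, Nat.div_eq_of_lt l.2, add_zero]
  have hi : (i : ℕ) = i' := by rw [← hdiv i j, h, hdiv]
  rw [hi] at h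
  exact ⟨Fin.ext hi, Fin.ext (by omega)⟩

section

variable {n : ℕ} {σ : State n} {s : Store}

lemma Rep.eval_entry {ρ : ℕ → Fin n} (h : Rep n (fun x => ρ x) σ s) (x y : ℕ) :
    (entry x y).eval s = ρ x * n + ρ y := by
  simp [entry, AExp.eval, h.var, h.table]

lemma Rep.eval_comp {ρ : ℕ → Fin n} (h : Rep n (fun x => ρ x) σ s) (t : Term) :
    t.comp.eval s = t.eval ρ σ := by
  induction t with
  | num | idx | acc => simp [Term.comp, Term.eval, AExp.eval, h.var, h.acc]
  | tmp | get1 | get2 =>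
    simp [Term.comp, Term.eval, AExp.eval, h.var, h.eval_entry, h.tmp, h.one, h.two]
  | add t u iht ihu | sub t u iht ihu => simp [Term.comp, Term.eval, AExp.eval, iht, ihu]

lemma Rep.setAcc {ρ : ℕ → ℕ} (h : Rep n ρ σ s) (k v : ℕ) :
    Rep n ρ { σ with acc := Function.update σ.acc k v } (s.setReg (3 * k + 2) v) where
  __ := h
  size := by rw [s.setReg_reg_of_ne v (by omega), h.size]
  var x := by rw [s.setReg_reg_of_ne v (by omega), h.var]
  acc m := by simp [Store.setReg_reg, Function.update_apply, h.acc]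

lemma Rep.setVar {ρ : ℕ → ℕ} (h : Rep n ρ σ s) (x v : ℕ) :
    Rep n (Function.update ρ x v) σ (s.setReg (3 * x + 1) v) where
  __ := h
  size := by rw [s.setReg_reg_of_ne v (by omega), h.size]
  var y := by simp [Store.setReg_reg, Function.update_apply, h.var]
  acc m := by rw [s.setReg_reg_of_ne v (by omega), h.acc]

lemma Rep.setSaved {ρ : ℕ → ℕ} (h : Rep n ρ σ s) (d v : ℕ) :
    Rep n ρ σ (s.setReg (3 * d + 3) v) where
  __ := h
  size := by rw [s.setReg_reg_of_ne v (by omega), h.size]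
  var x := by rw [s.setReg_reg_of_ne v (by omega), h.var]
  acc m := by rw [s.setReg_reg_of_ne v (by omega), h.acc]

lemma Rep.setTmp {ρ : ℕ → ℕ} (h : Rep n ρ σ s) (i j : Fin n) (v : ℕ) :
    Rep n ρ { σ with tmp := Function.update σ.tmp i (Function.update (σ.tmp i) j v) }
      (s.setArr 2 (i * n + j) v) where
  __ := h
  table k := by rw [Store.setArr_arr, if_neg (by omega), h.table]
  tmp k l := by
    rw [Store.setArr_arr]
    simp only [row_position, true_and, h.tmp]
    by_cases hk : k = i <;> by_cases hl : l = j <;> simp [hk, hl]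
  one b k := by rw [Store.setArr_arr, if_neg (by omega), h.one]
  two b k l := by rw [Store.setArr_arr, if_neg (by omega), h.two]

lemma Rep.setOne {ρ : ℕ → ℕ} (h : Rep n ρ σ s) (a : ℕ) (i : Fin n) (v : ℕ) :
    Rep n ρ { σ with mem.one :=
        Function.update σ.mem.one a (Function.update (σ.mem.one a) i v) }
      (s.setArr (2 * a + 1) i v) where
  __ := h
  table k := by rw [Store.setArr_arr, if_neg (by omega), h.table]
  tmp k l := by rw [Store.setArr_arr, if_neg (by omega), h.tmp]
  one b k := by
    rw [Store.setArr_arr]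
    by_cases hb : b = a
    · by_cases hk : k = i <;> simp [hb, hk, Fin.val_inj, h.one]
    · simp [hb, h.one]
  two b k l := by rw [Store.setArr_arr, if_neg (by omega), h.two]

lemma Rep.setTwo {ρ : ℕ → ℕ} (h : Rep n ρ σ s) (a : ℕ) (i j : Fin n) (v : ℕ) :
    Rep n ρ { σ with mem.two := Function.update σ.mem.two a (Function.update (σ.mem.two a) i
        (Function.update (σ.mem.two a i) j v)) }
      (s.setArr (4 * a) (i * n + j) v) where
  __ := h
  table k := by rw [Store.setArr_arr, if_neg (by omega), h.table]
  tmp k l := by rw [Store.setArr_arr, if_neg (by omega), h.tmp]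
  one b k := by rw [Store.setArr_arr, if_neg (by omega), h.one]
  two b k l := by
    rw [Store.setArr_arr]
    by_cases hb : b = a
    · simp only [hb, row_position, true_and, h.two]
      by_cases hk : k = i <;> by_cases hl : l = j <;> simp [hk, hl]
    · simp [hb, h.two]

end

/-- The effect of the compiled code `c` at depth `d`: the state changes as prescribed and the
registers in which the surrounding loops keep their variables do not change. -/
def Simulates (c : Code) (d n T : ℕ) : Prop :=
  ∀ (ρ : ℕ → Fin n) (σ : State n) (s : Store), Rep n (fun x => ρ x) σ s →
    Does (c.comp d) s T fun s' => Rep n (fun x => ρ x) (c.exec ρ σ) s' ∧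
      ∀ m < d, s'.reg (3 * m + 3) = s.reg (3 * m + 3)

lemma Simulates.loop {c : Code} {d n T : ℕ} (h : Simulates c (d + 1) n T) (x : ℕ) :
    Simulates (.loop x c) d n (n * (T + 9) + 13) := by
  intro ρ σ s hs
  let step (i : ℕ) (hi : i < n) (τ : State n) := c.exec (Function.update ρ x ⟨i, hi⟩) τ
  let I (i : ℕ) (s' : Store) : Prop := ∃ hi : i ≤ n,
    Rep n (Function.update (fun y => (ρ y : ℕ)) x i)
      (Nat.fold i (fun j hj => step j (hj.trans_le hi)) σ) s' ∧
    s'.reg (3 * d + 3) = ρ x ∧ ∀ m < d, s'.reg (3 * m + 3) = s.reg (3 * m + 3)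
  have hsave : Does (.assign (3 * d + 3) (.reg (3 * x + 1))) s 2 fun s' =>
      I 0 (s'.setReg (3 * x + 1) 0) := by
    refine does_assign ⟨n.zero_le, (hs.setSaved d _).setVar x 0, ?_, fun m hm => ?_⟩
    · rw [Store.setReg_reg_of_ne _ _ (by omega), Store.setReg_reg_self]
      exact hs.var x
    · rw [Store.setReg_reg_of_ne _ _ (by omega), Store.setReg_reg_of_ne _ _ (by omega)]
  refine (hsave.seq (T' := n * (T + 9) + 10) fun s₁ hs₁ => ?_).mono (by omega) fun _ h => h
  have hfor : Does (forReg (3 * x + 1) (c.comp (d + 1))) s₁ (n * (T + 9) + 7) (I n) := by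
    refine does_forReg I (fun i s' hs' => ⟨hs'.2.1.size, by simpa using hs'.2.1.var x⟩) ?_ hs₁
    rintro i hi s' ⟨_, hrep, hsaved, houter⟩
    have hρ : Function.update (fun y => (ρ y : ℕ)) x i =
        fun y => (Function.update ρ x ⟨i, hi⟩ y : ℕ) := by
      ext y; by_cases hy : y = x <;> simp [hy]
    refine (h _ _ s' (hρ ▸ hrep)).mono le_rfl fun s'' ⟨hrep', hsaved'⟩ => ?_
    refine ⟨by simpa using hrep'.var x, hi, ?_, ?_, fun m hm => ?_⟩
    · simpa [← hρ, Nat.fold_succ] using hrep'.setVar x (i + 1)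
    · rw [Store.setReg_reg_of_ne _ _ (by omega), hsaved' d (by omega), hsaved]
    · rw [Store.setReg_reg_of_ne _ _ (by omega), hsaved' m (by omega), houter m hm]
  refine (hfor.seq (T' := 2) fun s₂ ⟨_, hrep, hsaved, houter⟩ => ?_).mono le_rfl fun _ h => h
  refine does_assign ⟨?_, fun m hm => ?_⟩
  · simpa [AExp.eval, hsaved, Code.exec] using hrep.setVar x (ρ x)
  · rw [Store.setReg_reg_of_ne _ _ (by omega), houter m hm]

theorem exists_polynomial_simulates (c : Code) (d : ℕ) :
    ∃ q : Polynomial ℕ, ∀ n, Simulates c d n (q.eval n) := by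
  induction c generalizing d with
  | set k t =>
    refine ⟨.C (t.comp.cost + 1), fun n ρ σ s hs => ?_⟩
    rw [Polynomial.eval_C]
    exact does_assign ⟨hs.eval_comp t ▸ hs.setAcc k _,
      fun m _ => Store.setReg_reg_of_ne _ _ (by omega)⟩
  | storeTmp x y k =>
    refine ⟨6, fun n ρ σ s hs => (does_write ⟨?_, fun m _ => rfl⟩).mono (by simp [entry, AExp.cost])
      fun _ h => h⟩
    rw [hs.eval_entry, AExp.eval, hs.acc]
    exact hs.setTmp _ _ _
  | store1 a x k =>
    refine ⟨3, fun n ρ σ s hs => (does_write ⟨?_, fun m _ => rfl⟩).mono (by simp [AExp.cost])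
      fun _ h => h⟩
    rw [AExp.eval, AExp.eval, hs.acc, hs.var]
    exact hs.setOne _ _ _
  | store2 a x y k =>
    refine ⟨6, fun n ρ σ s hs => (does_write ⟨?_, fun m _ => rfl⟩).mono (by simp [entry, AExp.cost])
      fun _ h => h⟩
    rw [hs.eval_entry, AExp.eval, hs.acc]
    exact hs.setTwo _ _ _ _
  | seq c e ihc ihe =>
    obtain ⟨p, hp⟩ := ihc d
    obtain ⟨q, hq⟩ := ihe d
    refine ⟨p + q + 1, fun n ρ σ s hs => ?_⟩
    refine ((hp n ρ σ s hs).seq (T' := q.eval n) fun s' hs' => ?_).mono (by simp) fun _ h => h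
    exact (hq n ρ _ s' hs'.1).mono le_rfl fun s'' hs'' =>
      ⟨hs''.1, fun m hm => (hs''.2 m hm).trans (hs'.2 m hm)⟩
  | ite k c e ihc ihe =>
    obtain ⟨p, hp⟩ := ihc d
    obtain ⟨q, hq⟩ := ihe d
    refine ⟨p + q + 2, fun n ρ σ s hs => ?_⟩
    refine (does_ite (T := p.eval n) (T' := q.eval n) (fun h => ?_) fun h => ?_).mono
      (by simp [AExp.cost]; omega) fun _ h => h
    · rw [AExp.eval, hs.acc] at h
      simpa [Code.exec, h] using hp n ρ σ s hs
    · rw [AExp.eval, hs.acc] at h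
      simpa [Code.exec, h] using hq n ρ σ s hs
  | loop x c ih =>
    obtain ⟨p, hp⟩ := ih (d + 1)
    exact ⟨.X * (p + 9) + 13, fun n => by simpa using (hp n).loop x⟩

end RAM

/-! ### Expressions and statements -/

namespace RAM

/-- Expressions over a memory; `sum x e` is the sum of `e` over all values of the variable `x`. -/
inductive Expr where
  | num (c : ℕ)
  | idx (x : ℕ)
  | get1 (a x : ℕ)
  | get2 (a x y : ℕ)
  | add (e f : Expr)
  | sub (e f : Expr)
  | ite (c e f : Expr)
  | sum (x : ℕ) (e : Expr)

/-- The value of an expression; the test of `ite c e f` is `c ≠ 0`. -/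
def Expr.eval {n : ℕ} (σ : Mem n) : Expr → (ℕ → Fin n) → ℕ
  | .num c, _ => c
  | .idx x, ρ => ρ x
  | .get1 a x, ρ => σ.one a (ρ x)
  | .get2 a x y, ρ => σ.two a (ρ x) (ρ y)
  | .add e f, ρ => e.eval σ ρ + f.eval σ ρ
  | .sub e f, ρ => e.eval σ ρ - f.eval σ ρ
  | .ite c e f, ρ => if c.eval σ ρ ≠ 0 then e.eval σ ρ else f.eval σ ρ
  | .sum x e, ρ => ∑ i, e.eval σ (Function.update ρ x i)

/-- Statements. `vec a e` replaces vector `a` by the vector whose entry `i` is the value of `e` at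
`idx 0 = i`, and `mat a e` replaces matrix `a` by the matrix whose entry `i j` is the value of `e`
at `idx 1 = i` and `idx 0 = j`. -/
inductive Stmt where
  | vec (a : ℕ) (e : Expr)
  | mat (a : ℕ) (e : Expr)
  | seq (c d : Stmt)
  | loop (x : ℕ) (c : Stmt)

/-- The effect of a statement. -/
def Stmt.exec {n : ℕ} : Stmt → (ℕ → Fin n) → Mem n → Mem n
  | .vec a e, ρ, σ =>
    { σ with one := Function.update σ.one a fun i => e.eval σ (Function.update ρ 0 i) }
  | .mat a e, ρ, σ =>
    { σ with two := Function.update σ.two a fun i j =>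
        e.eval σ (Function.update (Function.update ρ 1 i) 0 j) }
  | .seq c d, ρ, σ => d.exec ρ (c.exec ρ σ)
  | .loop x c, ρ, σ => Nat.fold n (fun i hi τ => c.exec (Function.update ρ x ⟨i, hi⟩) τ) σ

lemma fold_induction {α : Type*} {n : ℕ} {f : ∀ i, i < n → α → α} {a : α} (I : ℕ → α → Prop)
    (zero : I 0 a) (succ : ∀ i hi b, I i b → I (i + 1) (f i hi b)) : I n (Nat.fold n f a) := by
  induction n with
  | zero => simpa using zero
  | succ n ih =>
    rw [Nat.fold_succ]
    exact succ n _ _ (ih fun i hi => succ i _)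

/-- Code that leaves the value of an expression in work register `k`, using only the work registers
from `k` on. -/
def Expr.comp : Expr → ℕ → Code
  | .num c, k => .set k (.num c)
  | .idx x, k => .set k (.idx x)
  | .get1 a x, k => .set k (.get1 a x)
  | .get2 a x y, k => .set k (.get2 a x y)
  | .add e f, k => .seq (e.comp k) (.seq (f.comp (k + 1)) (.set k (.add (.acc k) (.acc (k + 1)))))
  | .sub e f, k => .seq (e.comp k) (.seq (f.comp (k + 1)) (.set k (.sub (.acc k) (.acc (k + 1)))))
  | .ite c e f, k => .seq (c.comp k) (.ite k (e.comp k) (f.comp k))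
  | .sum x e, k => .seq (.set k (.num 0))
      (.loop x (.seq (e.comp (k + 1)) (.set k (.add (.acc k) (.acc (k + 1))))))

/-- The state `τ` arises from `σ` by putting `v` into work register `k`, using only the work
registers from `k` on. -/
structure Puts {n : ℕ} (k v : ℕ) (σ τ : State n) : Prop where
  value : τ.acc k = v
  acc : ∀ m < k, τ.acc m = σ.acc m
  tmp : τ.tmp = σ.tmp
  mem : τ.mem = σ.mem

section

variable {n : ℕ} {ρ : ℕ → Fin n} {σ τ : State n} {k v : ℕ}

lemma puts_set {t : Term} (h : t.eval ρ σ = v) : Puts k v σ ((Code.set k t).exec ρ σ) where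
  value := by simp [Code.exec, h]
  acc m hm := by simp [Code.exec, hm.ne]
  tmp := rfl
  mem := rfl

lemma Puts.trans {υ : State n} {u : ℕ} (h : Puts k u σ τ) (h' : Puts k v τ υ) : Puts k v σ υ where
  value := h'.value
  acc m hm := (h'.acc m hm).trans (h.acc m hm)
  tmp := h'.tmp.trans h.tmp
  mem := h'.mem.trans h.mem

lemma Puts.of_succ (h : Puts (k + 1) v σ τ) : Puts k (σ.acc k) σ τ where
  value := h.acc k k.lt_succ_self
  acc m hm := h.acc m (by omega)
  tmp := h.tmp
  mem := h.mem

lemma Puts.loop_sum {x : ℕ} {c : Code} {f : Fin n → ℕ}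
    (hc : ∀ i τ, τ.mem = σ.mem →
      Puts (k + 1) (f i) τ (c.exec (Function.update ρ x i) τ)) :
    Puts k (∑ i, f i) σ ((Code.seq (.set k (.num 0))
      (.loop x (.seq c (.set k (.add (.acc k) (.acc (k + 1))))))).exec ρ σ) := by
  let g (j : ℕ) : ℕ := if h : j < n then f ⟨j, h⟩ else 0
  have hg : ∑ i, f i = ∑ j ∈ Finset.range n, g j := by simp [Finset.sum_range, g]
  rw [hg]
  refine fold_induction (fun i τ => Puts k (∑ j ∈ Finset.range i, g j) σ τ)
    (puts_set rfl) fun i hi τ hτ => ?_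
  have hc' := hc ⟨i, hi⟩ τ hτ.mem
  refine (hτ.trans hc'.of_succ).trans (puts_set ?_)
  simp [Term.eval, hc'.value, hc'.of_succ.value, hτ.value, Finset.sum_range_succ, g, hi]

lemma Expr.puts_comp (e : Expr) (ρ : ℕ → Fin n) (σ : State n) (k : ℕ) :
    Puts k (e.eval σ.mem ρ) σ ((e.comp k).exec ρ σ) := by
  induction e generalizing ρ σ k with
  | num | idx | get1 | get2 => exact puts_set rfl
  | add e f ihe ihf | sub e f ihe ihf =>
    have he := ihe ρ σ k
    have hf := ihf ρ ((e.comp k).exec ρ σ) (k + 1)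
    refine (he.trans hf.of_succ).trans (puts_set ?_)
    simp only [Term.eval, hf.value, hf.of_succ.value, he.value, he.mem, Expr.eval]
  | ite c e f ihc ihe ihf =>
    have hc := ihc ρ σ k
    simp only [Expr.comp, Code.exec, Expr.eval, hc.value]
    split_ifs
    · exact hc.trans (hc.mem ▸ ihe ρ _ k)
    · exact hc.trans (hc.mem ▸ ihf ρ _ k)
  | sum x e ih => exact Puts.loop_sum fun i τ hτ => hτ ▸ ih _ τ (k + 1)

end

/-- Code for a statement. The new entries are collected in the scratch matrix (those of a vector on
its diagonal), so that the old ones remain available until all new ones are known. -/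
def Stmt.comp : Stmt → Code
  | .vec a e => .seq (.loop 0 (.seq (e.comp 0) (.storeTmp 0 0 0)))
      (.loop 0 (.seq (.set 0 (.tmp 0 0)) (.store1 a 0 0)))
  | .mat a e => .seq (.loop 1 (.loop 0 (.seq (e.comp 0) (.storeTmp 1 0 0))))
      (.loop 1 (.loop 0 (.seq (.set 0 (.tmp 1 0)) (.store2 a 1 0 0))))
  | .seq c d => .seq c.comp d.comp
  | .loop x c => .loop x c.comp

section

variable {n : ℕ} (ρ : ℕ → Fin n) (σ : State n)

/-- Nested loops over the variables `1` and `0`. -/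
lemma fold_fold_induction {α : Type*} {f : Fin n → Fin n → α → α} {a : α}
    (I : (Fin n → Fin n → Prop) → α → Prop) (zero : I (fun _ _ => False) a)
    (succ : ∀ P i j b, I P b → I (fun k l => P k l ∨ k = i ∧ l = j) (f i j b)) :
    I (fun _ _ => True)
      (Nat.fold n (fun i hi b => Nat.fold n (fun j hj b => f ⟨i, hi⟩ ⟨j, hj⟩ b) b) a) := by
  have hrow : ∀ P i b, I P b →
      I (fun k l => P k l ∨ k = i) (Nat.fold n (fun j hj b => f i ⟨j, hj⟩ b) b) := by
    intro P i b hb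
    have := fold_induction (f := fun j hj b => f i ⟨j, hj⟩ b)
      (fun m b => I (fun k l => P k l ∨ k = i ∧ (l : ℕ) < m) b) (by simpa using hb)
      fun j hj b hb => by
        convert succ _ i ⟨j, hj⟩ b hb using 3 with k l
        simp only [Fin.ext_iff, Nat.lt_succ_iff_lt_or_eq]
        tauto
    simpa using this
  have := fold_induction
    (f := fun i hi b => Nat.fold n (fun j hj b => f ⟨i, hi⟩ ⟨j, hj⟩ b) b)
    (fun m b => I (fun k _ => (k : ℕ) < m) b) (by simpa using zero)
    fun i hi b hb => by
      convert hrow _ ⟨i, hi⟩ b hb using 3 with k l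
      simp only [Fin.ext_iff, Nat.lt_succ_iff_lt_or_eq]
  simpa using this

lemma Code.exec_loop_storeTmp_diag (e : Expr) :
    let τ := (Code.loop 0 (.seq (e.comp 0) (.storeTmp 0 0 0))).exec ρ σ
    τ.mem = σ.mem ∧ ∀ i, τ.tmp i i = e.eval σ.mem (Function.update ρ 0 i) := by
  have := fold_induction
    (f := fun i hi => (Code.seq (e.comp 0) (.storeTmp 0 0 0)).exec (Function.update ρ 0 ⟨i, hi⟩))
    (a := σ) (fun m τ => τ.mem = σ.mem ∧
      ∀ i : Fin n, (i : ℕ) < m → τ.tmp i i = e.eval σ.mem (Function.update ρ 0 i))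
    (by simp) fun i hi τ ⟨hmem, htmp⟩ => by
      have he := e.puts_comp (Function.update ρ 0 ⟨i, hi⟩) τ 0
      refine ⟨he.mem.trans hmem, fun j hj => ?_⟩
      by_cases hji : j = ⟨i, hi⟩
      · simp [Code.exec, hji, he.value, hmem]
      · have : (j : ℕ) ≠ i := by simpa [Fin.ext_iff] using hji
        simp [Code.exec, hji, he.tmp, htmp j (by omega)]
  exact ⟨this.1, fun i => this.2 i i.2⟩

lemma Code.exec_loop_store1 (a : ℕ) :
    ((Code.loop 0 (.seq (.set 0 (.tmp 0 0)) (.store1 a 0 0))).exec ρ σ).mem =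
      { σ.mem with one := Function.update σ.mem.one a fun i => σ.tmp i i } := by
  have := fold_induction
    (f := fun i hi => (Code.seq (.set 0 (.tmp 0 0)) (.store1 a 0 0)).exec
      (Function.update ρ 0 ⟨i, hi⟩))
    (a := σ) (fun m τ => τ.tmp = σ.tmp ∧ τ.mem = { σ.mem with
      one := Function.update σ.mem.one a fun i =>
        if (i : ℕ) < m then σ.tmp i i else σ.mem.one a i })
    (by simp) fun i hi τ ⟨htmp, hmem⟩ => by
      refine ⟨htmp, ?_⟩
      simp only [Code.exec, Term.eval, hmem, htmp, Function.update_self, Function.update_idem]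
      congr 2
      ext j
      by_cases hji : j = ⟨i, hi⟩
      · simp [hji]
      · have : (j : ℕ) ≠ i := by simpa [Fin.ext_iff] using hji
        simp [hji, show (j : ℕ) < i + 1 ↔ (j : ℕ) < i by omega]
  simp only [Fin.is_lt, if_true] at this
  exact this.2

lemma Code.exec_loop_loop_storeTmp (e : Expr) :
    let τ := (Code.loop 1 (.loop 0 (.seq (e.comp 0) (.storeTmp 1 0 0)))).exec ρ σ
    τ.mem = σ.mem ∧
      ∀ i j, τ.tmp i j = e.eval σ.mem (Function.update (Function.update ρ 1 i) 0 j) := by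
  have := fold_fold_induction
    (f := fun i j => (Code.seq (e.comp 0) (.storeTmp 1 0 0)).exec
      (Function.update (Function.update ρ 1 i) 0 j))
    (a := σ) (fun P τ => τ.mem = σ.mem ∧ ∀ i j, P i j →
      τ.tmp i j = e.eval σ.mem (Function.update (Function.update ρ 1 i) 0 j))
    (by simp) fun P i j τ ⟨hmem, htmp⟩ => by
      have he := e.puts_comp (Function.update (Function.update ρ 1 i) 0 j) τ 0
      refine ⟨he.mem.trans hmem, fun k l hkl => ?_⟩
      by_cases hk : k = i <;> by_cases hl : l = j <;>
        simp_all [Code.exec, he.value, he.tmp]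
  exact ⟨this.1, fun i j => this.2 i j trivial⟩

open Classical in
lemma Code.exec_loop_loop_store2 (a : ℕ) :
    ((Code.loop 1 (.loop 0 (.seq (.set 0 (.tmp 1 0)) (.store2 a 1 0 0)))).exec ρ σ).mem =
      { σ.mem with two := Function.update σ.mem.two a σ.tmp } := by
  have := fold_fold_induction
    (f := fun i j => (Code.seq (.set 0 (.tmp 1 0)) (.store2 a 1 0 0)).exec
      (Function.update (Function.update ρ 1 i) 0 j))
    (a := σ) (fun P τ => τ.tmp = σ.tmp ∧ τ.mem = { σ.mem with
      two := Function.update σ.mem.two a fun i j => if P i j then σ.tmp i j else σ.mem.two a i j })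
    (by simp) fun P i j τ ⟨htmp, hmem⟩ => by
      refine ⟨htmp, ?_⟩
      simp only [Code.exec, Term.eval, hmem, htmp, Function.update_self, Function.update_idem]
      congr 2
      ext k l
      by_cases hk : k = i <;> by_cases hl : l = j <;> simp [hk, hl]
  simp only [if_true] at this
  exact this.2

end

lemma Stmt.exec_comp {n : ℕ} (c : Stmt) (ρ : ℕ → Fin n) (σ : State n) :
    (c.comp.exec ρ σ).mem = c.exec ρ σ.mem := by
  induction c generalizing ρ σ with
  | vec a e =>
    obtain ⟨hmem, htmp⟩ := Code.exec_loop_storeTmp_diag ρ σ e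
    rw [Stmt.comp, Code.exec, Code.exec_loop_store1, hmem]
    simp only [htmp, Stmt.exec]
  | mat a e =>
    obtain ⟨hmem, htmp⟩ := Code.exec_loop_loop_storeTmp ρ σ e
    rw [Stmt.comp, Code.exec, Code.exec_loop_loop_store2, hmem, Stmt.exec]
    simp only [← htmp]
  | seq c d ihc ihd => simp only [Stmt.comp, Code.exec, Stmt.exec, ihc, ihd]
  | loop x c ih =>
    have hfold : ∀ m (hm : m ≤ n), State.mem (Nat.fold m
        (fun i hi τ => c.comp.exec (Function.update ρ x ⟨i, hi.trans_le hm⟩) τ) σ) =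
        Nat.fold m (fun i hi τ => c.exec (Function.update ρ x ⟨i, hi.trans_le hm⟩) τ) σ.mem := by
      intro m
      induction m with
      | zero => simp
      | succ m ihm => intro hm; rw [Nat.fold_succ, Nat.fold_succ, ih, ihm (by omega)]
    exact hfold n le_rfl

/-! ### Whole programs -/

/-- Fill array `6` with the multiples of `n` and copy array `2` to array `5`. -/
def prelude : Prog :=
  forReg 2 (.seq (.write 6 (.reg 2) (.reg 5))
    (.seq (.assign 5 (.add (.reg 5) (.reg 0))) (.write 5 (.reg 2) (.read 2 (.reg 2)))))

lemma does_prelude {n : ℕ} {s : Store} (hn : s.reg 0 = n) (h5 : s.reg 5 = 0) :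
    Does prelude s (n * 22 + 7) fun s' =>
      (∀ x, x ≠ 2 → x ≠ 5 → s'.reg x = s.reg x) ∧
      (∀ a, a ≠ 5 → a ≠ 6 → s'.arr a = s.arr a) ∧
      ∀ j < n, s'.arr 6 j = j * n ∧ s'.arr 5 j = s.arr 2 j := by
  let I (i : ℕ) (s' : Store) : Prop := s'.reg 2 = i ∧ s'.reg 5 = i * n ∧
    (∀ x, x ≠ 2 → x ≠ 5 → s'.reg x = s.reg x) ∧
    (∀ a, a ≠ 5 → a ≠ 6 → s'.arr a = s.arr a) ∧
    ∀ j < i, s'.arr 6 j = j * n ∧ s'.arr 5 j = s.arr 2 j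
  refine (does_forReg (n := n) (T := 13) I ?_ ?_ ?_).mono le_rfl fun s' hs' => hs'.2.2
  · exact fun i s' hs' => ⟨(hs'.2.2.1 0 (by omega) (by omega)).trans hn, hs'.1⟩
  · rintro i - s' ⟨hi', hin, hreg, harr, htable⟩
    refine ((does_write (Q := (· = s'.setArr 6 i (i * n))) ?_).seq (T' := 9) ?_).mono
      (by simp [AExp.cost]) fun _ h => h
    · simp [AExp.eval, hi', hin]
    rintro _ rfl
    refine ((does_assign (Q := (· = (s'.setArr 6 i (i * n)).setReg 5 ((i + 1) * n))) ?_).seq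
      (T' := 4) ?_).mono (by simp [AExp.cost]) fun _ h => h
    · simp [AExp.eval, hin, hreg, hn, add_mul]
    rintro _ rfl
    refine (does_write ⟨?_, ?_, ?_, fun x hx hx' => ?_, fun a ha ha' => ?_, fun j hj => ?_⟩).mono
      (by simp [AExp.cost]) fun _ h => h
    · simp [Store.setReg_reg, hi']
    · simp
    · simp [Store.setReg_reg]
    · simp [Store.setReg_reg, hx, hx', hreg]
    · ext j
      simp [Store.setArr_arr, ha, ha', harr]
    · simp only [AExp.eval, Store.setReg_arr, Store.setArr_arr, Store.setReg_reg,
        Store.setArr_reg, hi']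
      have := harr 2 (by omega) (by omega)
      have := htable j
      grind
  · exact ⟨by simp, by simp [Store.setReg_reg, h5], fun x hx _ => s.setReg_reg_of_ne _ hx,
      fun _ _ _ => rfl, by simp⟩

/-- The memory of vectors and matrices that a store holds at the start: matrix `a` is in array
`4 * a` and vector `a` in array `2 * a + 1`, except that vector `2` is in array `2`. -/
def Mem.ofStore (n : ℕ) (s : Store) : Mem n where
  one a i := s.arr (if a = 2 then 2 else 2 * a + 1) i
  two a i j := s.arr (4 * a) (i * n + j)

/-- The program of a statement. Without indices, that is, for `n = 0`, it does nothing. -/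
def Stmt.program (c : Stmt) : Prog :=
  .ite (.reg 0) (.seq prelude (c.comp.comp 0)) .skip

theorem exists_polynomial_does_program (c : Stmt) : ∃ q : Polynomial ℕ, ∀ n s, s.reg 0 = n →
    (∀ x, x ≠ 0 → s.reg x = 0) → Does c.program s (q.eval n) fun s' =>
      ∀ z i : Fin n, (z : ℕ) = 0 →
        s'.arr 3 i = (c.exec (fun _ => z) (Mem.ofStore n s)).one 1 i := by
  obtain ⟨p, hp⟩ := exists_polynomial_simulates c.comp 0
  refine ⟨.X * 22 + p + 11, fun n s hn hs => (does_ite (T := n * 22 + 7 + p.eval n + 1) (T' := 1)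
    (fun h => (does_prelude hn (hs 5 (by omega))).seq fun s' ⟨hreg, harr, htable⟩ => ?_)
    fun h => does_skip fun z => ?_).mono (by simp [AExp.cost]; omega) fun _ h => h⟩
  · have hpos : 0 < n := by rw [AExp.eval, hn] at h; omega
    have hrep : Rep n (fun _ => ((⟨0, hpos⟩ : Fin n) : ℕ))
        ⟨fun k => s'.reg (3 * k + 2), fun i j => s'.arr 2 (i * n + j), .ofStore n s⟩ s' := by
      refine ⟨?_, fun x => ?_, fun _ => rfl, fun i => (htable i i.2).1, fun _ _ => rfl,
        fun a i => ?_, fun a i j => ?_⟩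
      · rw [hreg 0 (by omega) (by omega), hn]
      · rw [hreg _ (by omega) (by omega), hs _ (by omega)]
      · by_cases ha : a = 2
        · simp [Mem.ofStore, ha, (htable i i.2).2]
        · simp [Mem.ofStore, ha, harr (2 * a + 1) (by omega) (by omega)]
      · simp [Mem.ofStore, harr (4 * a) (by omega) (by omega)]
    refine (hp n (fun _ => ⟨0, hpos⟩) _ s' hrep).mono le_rfl fun s'' hs'' z i hz => ?_
    obtain rfl : z = ⟨0, hpos⟩ := Fin.ext hz
    rw [hs''.1.one 1 i, c.exec_comp]
  · rw [AExp.eval, hn] at h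
    exact absurd z.2 (by omega)

end RAM

/-! ### Logical and counting expressions -/

namespace RAM.Expr

/-- Negation. -/
def not (e : Expr) : Expr := .sub (.num 1) e

/-- Conjunction. -/
def and (e f : Expr) : Expr := .ite e f (.num 0)

/-- Disjunction. -/
def or (e f : Expr) : Expr := .ite e (.num 1) f

/-- Comparison. -/
def le (e f : Expr) : Expr := .not (.sub e f)

/-- Strict comparison. -/
def lt (e f : Expr) : Expr := .not (.le f e)

/-- Equality. -/
def eq (e f : Expr) : Expr := .and (.le e f) (.le f e)

/-- The truth value `0` or `1`. -/
def ind (e : Expr) : Expr := .ite e (.num 1) (.num 0)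

/-- The number of values of variable `x` for which `e` is true. -/
def count (x : ℕ) (e : Expr) : Expr := .sum x (.ind e)

/-- The formula `e` is true for some value of variable `x`. -/
def ex (x : ℕ) (e : Expr) : Expr := .sum x e

/-- The formula `e` is true for all values of variable `x`. -/
def all (x : ℕ) (e : Expr) : Expr := .not (.ex x (.not e))

/-- Expressions are true if their value is not `0`. -/
def IsTrue {n : ℕ} (σ : Mem n) (ρ : ℕ → Fin n) (e : Expr) : Prop := e.eval σ ρ ≠ 0

variable {n : ℕ} {σ : Mem n} {ρ : ℕ → Fin n} {e f g : Expr} {a x y : ℕ}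

@[simp] lemma eval_num {c : ℕ} : (num c).eval σ ρ = c := rfl

@[simp] lemma eval_idx : (idx x).eval σ ρ = ρ x := rfl

@[simp] lemma eval_get1 : (get1 a x).eval σ ρ = σ.one a (ρ x) := rfl

@[simp] lemma eval_get2 : (get2 a x y).eval σ ρ = σ.two a (ρ x) (ρ y) := rfl

@[simp] lemma eval_add : (add e f).eval σ ρ = e.eval σ ρ + f.eval σ ρ := rfl

@[simp] lemma true_num {c : ℕ} : IsTrue σ ρ (num c) ↔ c ≠ 0 := Iff.rfl

lemma true_get1 : IsTrue σ ρ (get1 a x) ↔ σ.one a (ρ x) ≠ 0 := Iff.rfl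

lemma true_get2 : IsTrue σ ρ (get2 a x y) ↔ σ.two a (ρ x) (ρ y) ≠ 0 := Iff.rfl

@[simp] lemma true_not : IsTrue σ ρ (not e) ↔ ¬ IsTrue σ ρ e := by
  simp only [IsTrue, not, eval]; omega

@[simp] lemma true_and : IsTrue σ ρ (and e f) ↔ IsTrue σ ρ e ∧ IsTrue σ ρ f := by
  simp only [IsTrue, and, eval]; split_ifs <;> simp [*]

@[simp] lemma true_or : IsTrue σ ρ (or e f) ↔ IsTrue σ ρ e ∨ IsTrue σ ρ f := by
  simp only [IsTrue, or, eval]; split_ifs <;> simp [*]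

@[simp] lemma true_le : IsTrue σ ρ (le e f) ↔ e.eval σ ρ ≤ f.eval σ ρ := by
  simp only [IsTrue, le, not, eval]; omega

@[simp] lemma true_lt : IsTrue σ ρ (lt e f) ↔ e.eval σ ρ < f.eval σ ρ := by
  simp [lt]

@[simp] lemma true_eq : IsTrue σ ρ (eq e f) ↔ e.eval σ ρ = f.eval σ ρ := by
  simp only [eq, true_and, true_le]; omega

@[simp] lemma true_ind : IsTrue σ ρ (ind e) ↔ IsTrue σ ρ e := by
  simp only [IsTrue, ind, eval]; split_ifs <;> simp [*]

@[simp] lemma true_ex : IsTrue σ ρ (ex x e) ↔ ∃ i, IsTrue σ (Function.update ρ x i) e := by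
  simp [IsTrue, ex, eval]

@[simp] lemma true_all : IsTrue σ ρ (all x e) ↔ ∀ i, IsTrue σ (Function.update ρ x i) e := by
  simp [all]

open Classical in
@[simp] lemma eval_ind : (ind e).eval σ ρ = if IsTrue σ ρ e then 1 else 0 := by
  simp only [ind, eval, IsTrue]; congr

open Classical in
@[simp] lemma eval_count : (count x e).eval σ ρ =
    (Finset.univ.filter fun i => IsTrue σ (Function.update ρ x i) e).card := by
  simp [count, eval]

open Classical in
@[simp] lemma eval_ite :
    (ite e f g).eval σ ρ = if IsTrue σ ρ e then f.eval σ ρ else g.eval σ ρ := by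
  simp only [IsTrue, eval]; congr

end RAM.Expr

/-! ### Block graphs -/

namespace VectorConnectivity

open SimpleGraph

section

variable {V : Type*} {G : SimpleGraph V} {v u w : V}

lemma isBiconnected_induce {s : Set V} (hs : (G.induce s).Connected)
    (hcut : ∀ x ∈ s, (G.induce (s \ {x})).Preconnected) :
    IsBiconnected ((⊤ : G.Subgraph).induce s).coe := by
  refine ⟨induce_eq_coe_induce_top s ▸ hs, ?_⟩
  rintro ⟨x, hx⟩ ⟨⟨⟨a, ha⟩, hax⟩, ⟨⟨b, hb⟩, hbx⟩, -, hab⟩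
  let f : G.induce (s \ {x}) →g
      ((⊤ : G.Subgraph).induce s).coe.induce ({⟨x, hx⟩}ᶜ : Set s) :=
    { toFun := fun z => ⟨⟨z, z.2.1⟩, fun h => z.2.2 (congrArg Subtype.val h)⟩
      map_rel' := fun {y z} h => ⟨y.2.1, z.2.1, h⟩ }
  exact hab ((hcut x hx ⟨a, ha, by simpa using hax⟩ ⟨b, hb, by simpa using hbx⟩).map f)

lemma isBiconnected_induce_cycle (hu : G.Adj v u) (hw : G.Adj v w) {p : G.Walk u w}
    (hp : p.IsPath) (hv : v ∉ p.support) :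
    IsBiconnected ((⊤ : G.Subgraph).induce (insert v {z | z ∈ p.support})).coe := by
  have hpath := p.connected_induce_support
  refine isBiconnected_induce ?_ fun x hx => ?_
  · have hv : (G.induce {v}).Preconnected := .of_subsingleton
    exact connected_induce_union hv hpath.preconnected rfl p.start_mem_support hu
  by_cases hxv : x = v
  · have hsdiff : insert v {z | z ∈ p.support} \ {v} = {z | z ∈ p.support} :=
      Set.insert_sdiff_self_of_notMem hv
    rw [hxv, hsdiff]
    exact hpath.preconnected
  have hvs : v ∈ insert v {z | z ∈ p.support} \ {x} := ⟨.inl rfl, Ne.symm hxv⟩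
  suffices h : ∀ y, (G.induce (insert v {z | z ∈ p.support} \ {x})).Reachable y ⟨v, hvs⟩ from
    fun a b => (h a).trans (h b).symm
  rintro ⟨y, rfl | hy, hyx⟩
  · rfl
  obtain ⟨q, r, -, -, rfl⟩ := hp.mem_support_iff_exists_append.1 hy
  obtain hxq | hxr : x ∉ q.support ∨ x ∉ r.support := by
    by_contra! h
    exact hp.ne_of_mem_support_of_append (Ne.symm hyx) h.1 h.2 rfl
  · exact ((q.reverse.concat hu.symm).induce _ (by simp; grind)).reachable
  · exact ((r.concat hw.symm).induce _ (by simp; grind)).reachable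

lemma IsBlockGraph.isClique [Finite V] (hG : IsBlockGraph G) {s : Set V}
    (hs : IsBiconnected ((⊤ : G.Subgraph).induce s).coe) : G.IsClique s := by
  intro a ha b hb hab
  obtain ⟨B, hsB, hB⟩ :=
    Finite.exists_le_maximal (p := fun H : G.Subgraph => IsBiconnected H.coe) hs
  have hadj : B.coe.Adj ⟨a, hsB.1 ha⟩ ⟨b, hsB.1 hb⟩ := by
    rw [hG B hB, top_adj]
    simpa using hab
  exact B.adj_sub hadj

lemma IsBlockGraph.adj_of_walk [Finite V] (hG : IsBlockGraph G) (hu : G.Adj v u) (hw : G.Adj v w)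
    (huw : u ≠ w) (p : G.Walk u w) (hp : v ∉ p.support) : G.Adj u w := by
  classical
  have hv : v ∉ p.bypass.support := fun h => hp (p.support_bypass_subset_support h)
  exact hG.isClique (isBiconnected_induce_cycle hu hw p.bypass_isPath hv)
    (.inr p.bypass.start_mem_support) (.inr p.bypass.end_mem_support) huw

end

/-! ### Betweenness -/

section

variable {V : Type*} {G : SimpleGraph V} {a b u v w x y ρ : V}

/-- `x` lies on a shortest path from `a` to `b`. -/
structure Btw (G : SimpleGraph V) (a x b : V) : Prop where
  left : G.Reachable a x
  right : G.Reachable x b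
  dist_eq : G.dist a x + G.dist x b = G.dist a b

lemma Btw.reachable (h : Btw G a x b) : G.Reachable a b := h.left.trans h.right

lemma Btw.symm (h : Btw G a x b) : Btw G b x a :=
  ⟨h.right.symm, h.left.symm, by rw [dist_comm, add_comm, dist_comm, h.dist_eq, dist_comm]⟩

lemma Btw.refl_right (h : G.Reachable a b) : Btw G a b b := ⟨h, .rfl, by simp⟩

lemma Btw.trans (h : Btw G a x y) (h' : Btw G a y b) : Btw G a x b := by
  refine ⟨h.left, h.right.trans h'.right, ?_⟩
  have := h.dist_eq
  have := h'.dist_eq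
  have := h.right.dist_triangle_left b
  have := h.left.dist_triangle_left b
  omega

lemma Btw.dist_lt (h : Btw G a x b) (hxb : x ≠ b) : G.dist a x < G.dist a b := by
  have := h.dist_eq
  have := h.right.pos_dist_of_ne hxb
  omega

lemma exists_walk_btw (h : G.Reachable a b) :
    ∃ p : G.Walk a b, ∀ z ∈ p.support, Btw G a z b := by
  classical
  obtain ⟨p, hp⟩ := h.exists_walk_length_eq_dist
  refine ⟨p, fun z hz => ⟨(p.takeUntil z hz).reachable, (p.dropUntil z hz).reachable, ?_⟩⟩
  have := dist_le (p.takeUntil z hz)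
  have := dist_le (p.dropUntil z hz)
  have := congrArg Walk.length (p.take_spec hz)
  rw [Walk.length_append] at this
  have := (p.takeUntil z hz).reachable.dist_triangle_left b
  omega

lemma dist_le_succ_of_adj (h : G.Adj u v) : G.dist a v ≤ G.dist a u + 1 := by
  simpa [dist_eq_one_iff_adj.2 h] using h.reachable.dist_triangle_right a

lemma exists_adj_btw (h : G.Reachable a b) (hab : a ≠ b) : ∃ x, G.Adj a x ∧ Btw G a x b := by
  obtain ⟨p, hp⟩ := h.exists_walk_length_eq_dist
  cases p with
  | nil => exact absurd rfl hab
  | @cons _ x _ hx q =>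
    refine ⟨x, hx, hx.reachable, q.reachable, ?_⟩
    have := dist_le q
    have := hx.reachable.dist_triangle_left b
    rw [dist_eq_one_iff_adj.2 hx] at this ⊢
    rw [Walk.length_cons] at hp
    omega

lemma IsBlockGraph.mem_support_of_btw [Finite V] (hG : IsBlockGraph G) (h : Btw G a x b)
    (p : G.Walk a b) : x ∈ p.support := by
  by_contra hx
  obtain ⟨y, hxy, hy⟩ := exists_adj_btw h.left.symm fun h => hx (h ▸ p.start_mem_support)
  obtain ⟨z, hxz, hz⟩ := exists_adj_btw h.right fun h => hx (h ▸ p.end_mem_support)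
  obtain ⟨q, hq⟩ := exists_walk_btw hy.right
  obtain ⟨q', hq'⟩ := exists_walk_btw hz.right
  have hya := hy.dist_eq
  have hzb := hz.dist_eq
  have hab := h.dist_eq
  rw [dist_eq_one_iff_adj.2 hxy, dist_comm (v := a), dist_comm (v := a)] at hya
  rw [dist_eq_one_iff_adj.2 hxz] at hzb
  have hshort : G.dist a b ≤ G.dist a y + G.dist y b := hy.right.symm.dist_triangle_left b
  have hyz : y ≠ z := by rintro rfl; omega
  have hadj : G.Adj y z := hG.adj_of_walk hxy hxz hyz (q.append (p.append q'.reverse)) fun hxs => by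
    simp only [Walk.mem_support_append_iff, Walk.support_reverse, List.mem_reverse] at hxs
    rcases hxs with hxq | hxp | hxq'
    · have := (hq x hxq).dist_eq
      rw [dist_comm (v := a), dist_comm (v := a)] at this
      omega
    · exact hx hxp
    · have := (hq' x hxq').dist_eq
      omega
  have := hadj.reachable.dist_triangle_left b
  rw [dist_eq_one_iff_adj.2 hadj] at this
  omega

/-- In a block graph there is only one shortest path between two vertices, and all other paths run
through its vertices. -/
lemma IsBlockGraph.btw_iff [Finite V] (hG : IsBlockGraph G) :
    Btw G a x b ↔ G.Reachable a b ∧ ∀ p : G.Walk a b, x ∈ p.support := by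
  refine ⟨fun h => ⟨h.reachable, hG.mem_support_of_btw h⟩, fun ⟨h, hx⟩ => ?_⟩
  obtain ⟨p, hp⟩ := exists_walk_btw h
  exact hp x (hx p)

lemma IsBlockGraph.btw_unique [Finite V] (hG : IsBlockGraph G) (hx : Btw G a x b)
    (hy : Btw G a y b) (h : G.dist a x = G.dist a y) : x = y := by
  obtain ⟨q, hq⟩ := exists_walk_btw hx.left
  obtain ⟨q', hq'⟩ := exists_walk_btw hx.right
  have hmem := hG.mem_support_of_btw hy (q.append q')
  rw [Walk.mem_support_append_iff] at hmem
  by_contra hxy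
  rcases hmem with hyq | hyq'
  · exact ((hq y hyq).dist_lt (Ne.symm hxy)).ne h.symm
  · have := hx.dist_eq
    have := hy.dist_eq
    have := (hq' y hyq').dist_eq
    have := (hq' y hyq').left.pos_dist_of_ne hxy
    omega

/-- The directions at `v` that do not lead to `ρ` may be judged from `ρ`: a shortest path from `ρ`
to `v` does not meet `u`. -/
lemma IsBlockGraph.btw_iff_of_dist_le [Finite V] (hG : IsBlockGraph G) (hv : G.Reachable ρ v)
    (huv : u ≠ v) (hd : G.dist ρ v ≤ G.dist ρ u) : Btw G v u w ↔ Btw G ρ u w := by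
  obtain ⟨q, hq⟩ := exists_walk_btw hv
  have hu : u ∉ q.support := fun h => ((hq u h).dist_lt huv).not_ge hd
  simp only [hG.btw_iff]
  refine and_congr ⟨hv.trans, hv.symm.trans⟩ ⟨fun h p => ?_, fun h p => ?_⟩
  · have := h (q.reverse.append p)
    simp only [Walk.mem_support_append_iff, Walk.support_reverse, List.mem_reverse] at this
    exact this.resolve_left hu
  · exact ((Walk.mem_support_append_iff _ _).1 (h (q.append p))).resolve_left hu

end

/-! ### Fans in block graphs -/

section

variable {V : Type*} {G : SimpleGraph V} {v w x y : V} {T : Set V} {k : ℕ}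

/-- `x` is the first vertex after `v` on a shortest path from `v` to `w`, or `x = v = w`. -/
def FirstStep (G : SimpleGraph V) (v x w : V) : Prop :=
  (x = v ∧ w = v) ∨ (G.Adj v x ∧ Btw G v x w)

lemma FirstStep.btw (h : FirstStep G v x w) : Btw G v x w := by
  obtain ⟨rfl, rfl⟩ | h := h
  exacts [.refl_right .rfl, h.2]

lemma FirstStep.self_iff (h : FirstStep G v x w) : x = v ↔ w = v := by
  rcases h with h | ⟨hadj, hbtw⟩
  · simp only [h]
  · refine iff_of_false hadj.ne' ?_
    rintro rfl
    have := hbtw.dist_eq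
    rw [dist_eq_one_iff_adj.2 hadj, SimpleGraph.dist_self] at this
    omega

lemma IsBlockGraph.firstStep_unique [Finite V] (hG : IsBlockGraph G) (hx : FirstStep G v x w)
    (hy : FirstStep G v y w) : x = y := by
  by_cases hw : w = v
  · rw [hx.self_iff.2 hw, hy.self_iff.2 hw]
  · have hvx := hx.resolve_left fun h => hw h.2
    have hvy := hy.resolve_left fun h => hw h.2
    refine hG.btw_unique hx.btw hy.btw ?_
    rw [dist_eq_one_iff_adj.2 hvx.1, dist_eq_one_iff_adj.2 hvy.1]

lemma exists_firstStep (h : G.Reachable v w) : ∃ x, FirstStep G v x w := by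
  by_cases hvw : v = w
  · exact ⟨v, .inl ⟨rfl, hvw.symm⟩⟩
  · obtain ⟨x, hx⟩ := exists_adj_btw h hvw
    exact ⟨x, .inr hx⟩

lemma FirstStep.exists_path (h : FirstStep G v x w) :
    ∃ P : G.Path v w, ∀ z ∈ P.1.support, z = v ∨ FirstStep G v x z := by
  classical
  obtain ⟨rfl, rfl⟩ | ⟨hadj, hbtw⟩ := h
  · exact ⟨.nil, by simp⟩
  obtain ⟨q, hq⟩ := exists_walk_btw hbtw.right
  refine ⟨(Walk.cons hadj q).toPath, fun z hz => ?_⟩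
  have hz := Walk.support_toPath_subset_support _ hz
  rw [Walk.support_cons, List.mem_cons] at hz
  refine hz.imp_right fun hz => .inr ⟨hadj, hadj.reachable, (hq z hz).left, ?_⟩
  have := (hq z hz).dist_eq
  have := hbtw.dist_eq
  have := (hadj.reachable.trans (hq z hz).left).dist_triangle_left w
  have := hadj.reachable.dist_triangle_left z
  omega

open Classical in
/-- The first vertices of the shortest paths from `v` to `T`. -/
noncomputable def dirs [Fintype V] (G : SimpleGraph V) (v : V) (T : Set V) : Finset V :=
  Finset.univ.filter fun x => ∃ w ∈ T, FirstStep G v x w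

lemma mem_dirs [Fintype V] : x ∈ dirs G v T ↔ ∃ w ∈ T, FirstStep G v x w := by
  simp [dirs]

lemma IsBlockGraph.le_card_dirs_of_isLinked [Fintype V] (hG : IsBlockGraph G)
    (h : IsLinked G v T k) : k ≤ (dirs G v T).card := by
  obtain ⟨e, P, he, hT, hP⟩ := h
  choose x hx using fun i => exists_firstStep (P i).1.reachable
  have hinj : Function.Injective x := by
    intro i j hij
    by_contra hne
    have hi := hG.mem_support_of_btw (hx i).btw (P i).1
    have hj := hG.mem_support_of_btw (hx j).btw (P j).1
    have hv : x i = v := hP i j hne _ hi (hij ▸ hj)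
    exact hne (he (((hx i).self_iff.1 hv).trans ((hx j).self_iff.1 (hij ▸ hv)).symm))
  calc k = (Finset.univ.map ⟨x, hinj⟩).card := by simp
    _ ≤ _ := Finset.card_le_card fun y hy => by
      obtain ⟨i, -, rfl⟩ := Finset.mem_map.1 hy
      exact mem_dirs.2 ⟨e i, hT i, hx i⟩

lemma IsBlockGraph.isLinked_of_le_card_dirs [Fintype V] (hG : IsBlockGraph G)
    (hk : k ≤ (dirs G v T).card) : IsLinked G v T k := by
  obtain ⟨f⟩ := Function.Embedding.nonempty_of_card_le
    (α := Fin k) (β := dirs G v T) (by simpa using hk)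
  choose w hw hx using fun i => mem_dirs.1 (f i).2
  choose P hP using fun i => (hx i).exists_path
  have hf : ∀ {i j z}, FirstStep G v (f i) z → FirstStep G v (f j) z → i = j := fun hi hj =>
    f.injective (Subtype.ext (hG.firstStep_unique hi hj))
  refine ⟨w, P, fun i j hij => hf (hx i) (hij ▸ hx j), hw, fun i j hij z hi hj => ?_⟩
  by_contra hz
  exact hij (hf ((hP i z hi).resolve_left hz) ((hP j z hj).resolve_left hz))

lemma IsBlockGraph.isLinked_iff [Fintype V] (hG : IsBlockGraph G) :
    IsLinked G v T k ↔ k ≤ (dirs G v T).card :=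
  ⟨hG.le_card_dirs_of_isLinked, hG.isLinked_of_le_card_dirs⟩

end

/-! ### Rooted block graphs -/

section

variable {V : Type*} {G : SimpleGraph V} {ρ u v w : V} {T : Set V}

/-- `u` equals `v`, or it is a neighbour of `v` with the same distance from `ρ`. -/
def Sib (G : SimpleGraph V) (ρ v u : V) : Prop :=
  u = v ∨ (G.Adj v u ∧ G.dist ρ u = G.dist ρ v)

lemma Sib.dist_eq (h : Sib G ρ v u) : G.dist ρ u = G.dist ρ v := by
  obtain rfl | h := h
  exacts [rfl, h.2]

lemma Sib.reachable (h : Sib G ρ v u) (hv : G.Reachable ρ v) : G.Reachable ρ u := by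
  obtain rfl | h := h
  exacts [hv, hv.trans h.1.reachable]

lemma Sib.symm (h : Sib G ρ v u) : Sib G ρ u v := by
  obtain rfl | h := h
  exacts [.inl rfl, .inr ⟨h.1.symm, h.2.symm⟩]

lemma Sib.ne (h : Sib G ρ v u) (hv : G.Reachable ρ v) (hvρ : v ≠ ρ) : u ≠ ρ := by
  rintro rfl
  have := h.dist_eq
  rw [SimpleGraph.dist_self] at this
  exact hvρ (hv.dist_eq_zero_iff.1 this.symm).symm

lemma IsBlockGraph.sib_trans [Finite V] (hG : IsBlockGraph G) (hv : G.Reachable ρ v)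
    (hu : Sib G ρ v u) (hw : Sib G ρ v w) : Sib G ρ u w := by
  by_cases huw : w = u
  · exact .inl huw
  rcases hu with rfl | hu
  · exact hw
  rcases hw with rfl | hw
  · exact .inr ⟨hu.1.symm, hu.2.symm⟩
  obtain ⟨q, hq⟩ := exists_walk_btw (hv.trans hu.1.reachable)
  obtain ⟨q', hq'⟩ := exists_walk_btw (hv.trans hw.1.reachable)
  refine .inr ⟨hG.adj_of_walk hu.1 hw.1 (Ne.symm huw) (q.reverse.append q') fun h => ?_,
    hw.2.trans hu.2.symm⟩
  simp only [Walk.mem_support_append_iff, Walk.support_reverse, List.mem_reverse] at h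
  rcases h with h | h
  · exact ((hq v h).dist_lt hu.1.ne).ne hu.2.symm
  · exact ((hq' v h).dist_lt hw.1.ne).ne hw.2.symm

/-- A shortest path from `ρ` through `u` contains a vertex of `T`. -/
def Hit (G : SimpleGraph V) (ρ : V) (T : Set V) (u : V) : Prop := ∃ w ∈ T, Btw G ρ u w

variable [Fintype V]

open Classical in
/-- The neighbours of `v` not closer to `ρ` than `v` that are hit by `T`. -/
noncomputable def hitNb (G : SimpleGraph V) (ρ : V) (T : Set V) (v : V) : Finset V :=
  Finset.univ.filter fun u => G.Adj v u ∧ G.dist ρ v ≤ G.dist ρ u ∧ Hit G ρ T u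

open Classical in
/-- The neighbours of `v` farther from `ρ` than `v` that are hit by `T`. -/
noncomputable def hitKids (G : SimpleGraph V) (ρ : V) (T : Set V) (v : V) : Finset V :=
  Finset.univ.filter fun u => G.Adj v u ∧ G.dist ρ u = G.dist ρ v + 1 ∧ Hit G ρ T u

lemma mem_hitNb :
    u ∈ hitNb G ρ T v ↔ G.Adj v u ∧ G.dist ρ v ≤ G.dist ρ u ∧ Hit G ρ T u := by
  simp [hitNb]

lemma mem_hitKids :
    u ∈ hitKids G ρ T v ↔ G.Adj v u ∧ G.dist ρ u = G.dist ρ v + 1 ∧ Hit G ρ T u := by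
  simp [hitKids]

lemma IsBlockGraph.mem_dirs_iff (hG : IsBlockGraph G) {p : V} (hp : G.Adj v p) (hpρ : Btw G v p ρ)
    (hT : ρ ∈ T) : u ∈ dirs G v T ↔ (u = v ∧ v ∈ T) ∨ u = p ∨ u ∈ hitNb G ρ T v := by
  have hv : G.Reachable ρ v := hpρ.reachable.symm
  have hlt : G.dist ρ p < G.dist ρ v := hpρ.symm.dist_lt hp.ne'
  by_cases huv : u = v
  · subst huv
    have hself : u ∈ dirs G u T ↔ u ∈ T :=
      mem_dirs.trans ⟨fun ⟨w, hw, h⟩ => h.self_iff.1 rfl ▸ hw, fun h => ⟨u, h, .inl ⟨rfl, rfl⟩⟩⟩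
    simp [hself, mem_hitNb, hp.ne]
  have hdirs : u ∈ dirs G v T ↔ G.Adj v u ∧ ∃ w ∈ T, Btw G v u w := by
    simp only [mem_dirs, FirstStep, huv, false_and, false_or]
    tauto
  by_cases hle : G.dist ρ v ≤ G.dist ρ u
  · have hup : u ≠ p := by rintro rfl; omega
    simp [hdirs, mem_hitNb, huv, hup, hle, Hit, hG.btw_iff_of_dist_le hv huv hle]
  · simp only [hdirs, huv, mem_hitNb, hle, false_and, and_false, false_or, or_false]
    refine ⟨fun ⟨hvu, _⟩ => ?_, fun h => h ▸ ⟨hp, ρ, hT, hpρ⟩⟩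
    have hvu1 := dist_eq_one_iff_adj.2 hvu
    have hu : Btw G v u ρ := by
      refine ⟨hvu.reachable, hvu.symm.reachable.trans hpρ.reachable, ?_⟩
      have := dist_le_succ_of_adj (a := ρ) hvu.symm
      rw [hvu1, SimpleGraph.dist_comm, SimpleGraph.dist_comm (u := v)]
      omega
    exact hG.btw_unique hu hpρ (hvu1.trans (dist_eq_one_iff_adj.2 hp).symm)

open Classical in
/-- The additional `1` is the direction towards `ρ`. -/
lemma IsBlockGraph.card_dirs (hG : IsBlockGraph G) (hv : G.Reachable ρ v) (hvρ : v ≠ ρ)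
    (hT : ρ ∈ T) :
    (dirs G v T).card = (if v ∈ T then 1 else 0) + 1 + (hitNb G ρ T v).card := by
  obtain ⟨p, hp, hpρ⟩ := exists_adj_btw hv.symm hvρ
  have hpN : p ∉ hitNb G ρ T v := fun h => (hpρ.symm.dist_lt hp.ne').not_ge (mem_hitNb.1 h).2.1
  have hvN : v ∉ insert p (hitNb G ρ T v) := by simp [hp.ne, mem_hitNb]
  split_ifs with hvT
  · have : dirs G v T = insert v (insert p (hitNb G ρ T v)) := by
      ext u; simp [hG.mem_dirs_iff hp hpρ hT, hvT]
    rw [this, Finset.card_insert_of_notMem hvN, Finset.card_insert_of_notMem hpN]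
    omega
  · have : dirs G v T = insert p (hitNb G ρ T v) := by
      ext u; simp [hG.mem_dirs_iff hp hpρ hT, hvT]
    rw [this, Finset.card_insert_of_notMem hpN]
    omega

end

end VectorConnectivity

/-! ### The optimal choice in one block -/

namespace VectorConnectivity

lemma card_filter_card_lt {α : Type*} [LinearOrder α] (A : Finset α) (m : ℕ) :
    (A.filter fun x => (A.filter fun y => y < x).card < m).card = min m A.card := by
  induction A using Finset.induction_on_max with
  | empty => simp
  | insert a A ha ih =>
    have haA : a ∉ A := fun h => lt_irrefl _ (ha a h)
    have hbelow_a : (insert a A).filter (fun y => y < a) = A := by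
      rw [Finset.filter_insert, if_neg (lt_irrefl a), Finset.filter_true_of_mem ha]
    have hbelow : ∀ x ∈ A, (insert a A).filter (fun y => y < x) = A.filter fun y => y < x :=
      fun x hx => by rw [Finset.filter_insert, if_neg (ha x hx).not_gt]
    rw [Finset.filter_insert, hbelow_a, Finset.filter_congr fun x hx => by rw [hbelow x hx],
      Finset.card_insert_of_notMem haA]
    split_ifs with h
    · rw [Finset.card_insert_of_notMem (by simp [haA]), ih]
      omega
    · rw [ih]
      omega

/-- The choice to be made in one block: some vertices of `block` are already hit from outside, the
vertex `x` has the requirement `req x`, and `cap x` of it is met by directions outside the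
block. -/
structure BlockProblem (α : Type*) where
  block : Finset α
  hit : α → Prop
  req : α → ℕ
  cap : α → ℕ

namespace BlockProblem

section

variable {α : Type*} (P : BlockProblem α)

open Classical in
/-- With `h` vertices of the block hit, the requirement of `x` is not met. A vertex that is hit
itself is not a direction of its own. -/
def Short (h : ℕ) (x : α) : Prop := h + P.cap x < P.req x + if P.hit x then 1 else 0

open Classical in
/-- The number of vertices of the block that are hit if those of `X` are chosen. -/
noncomputable def hits (X : Finset α) : ℕ := (P.block.filter fun x => P.hit x ∨ x ∈ X).card

/-- The requirements in the block are met if the vertices of `X` are chosen. -/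
def Feasible (X : Finset α) : Prop := ∀ x ∈ P.block, x ∉ X → ¬ P.Short (P.hits X) x

/-- `X` has minimum size among the feasible choices, and it hits the most vertices among those. -/
def IsOptimal (X : Finset α) : Prop := X ⊆ P.block ∧ P.Feasible X ∧
  ∀ Y ⊆ P.block, P.Feasible Y → X.card ≤ Y.card ∧ (X.card = Y.card → P.hits Y ≤ P.hits X)

open Classical in
/-- The number of vertices of the block that are hit before the choice. -/
noncomputable def hitCount : ℕ := (P.block.filter fun x => P.hit x).card

open Classical in
/-- The number of vertices not yet hit that have to be chosen if `h` vertices are to be hit. -/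
noncomputable def freshCount (h : ℕ) : ℕ :=
  (P.block.filter fun x => ¬ P.hit x ∧ P.Short h x).card

/-- Some feasible choice makes `h` the number of vertices hit. -/
def Attainable (h : ℕ) : Prop := P.freshCount h + P.hitCount ≤ h ∧ h ≤ P.block.card

open Classical in
/-- The least size of a feasible choice for which `h` vertices are hit, up to the constant
`hitCount`: every vertex hit that is not hit already costs one choice, and so does every vertex
hit already that remains short. -/
noncomputable def price (h : ℕ) : ℕ := (P.block.filter fun x => P.hit x ∧ P.Short h x).card + h

/-- `h` is the largest number of vertices to be hit at the least price. -/
def IsBest (h : ℕ) : Prop := P.Attainable h ∧ ∀ h', P.Attainable h' →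
  P.price h < P.price h' ∨ (P.price h = P.price h' ∧ h' ≤ h)

variable {P}

lemma IsBest.unique {h h' : ℕ} (hh : P.IsBest h) (hh' : P.IsBest h') : h = h' := by
  have := hh.2 h' hh'.1
  have := hh'.2 h hh.1
  omega

lemma IsBest.le_card {h : ℕ} (hh : P.IsBest h) : h ≤ P.block.card := hh.1.2

open Classical in
lemma hits_eq {Y : Finset α} (hY : Y ⊆ P.block) :
    P.hits Y = P.hitCount + (Y.filter fun x => ¬ P.hit x).card := by
  rw [hits, hitCount, ← Finset.card_union_of_disjoint]
  · congr 1
    ext x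
    have := @hY x
    simp only [Finset.mem_filter, Finset.mem_union]
    tauto
  · simp only [Finset.disjoint_left, Finset.mem_filter]
    tauto

lemma Feasible.attainable {Y : Finset α} (hY : Y ⊆ P.block) (hok : P.Feasible Y) :
    P.Attainable (P.hits Y) := by
  classical
  have hfresh : P.freshCount (P.hits Y) ≤ (Y.filter fun x => ¬ P.hit x).card := by
    refine Finset.card_le_card fun x hx => ?_
    rw [Finset.mem_filter] at hx ⊢
    exact ⟨by_contra fun hxY => hok x hx.1 hxY hx.2.2, hx.2.1⟩
  have := hits_eq hY
  exact ⟨by omega, Finset.card_filter_le _ _⟩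

lemma Feasible.price_le {Y : Finset α} (hY : Y ⊆ P.block) (hok : P.Feasible Y) :
    P.price (P.hits Y) ≤ Y.card + P.hitCount := by
  classical
  have hshort : (P.block.filter fun x => P.hit x ∧ P.Short (P.hits Y) x).card ≤
      (Y.filter fun x => P.hit x).card := by
    refine Finset.card_le_card fun x hx => ?_
    rw [Finset.mem_filter] at hx ⊢
    exact ⟨by_contra fun hxY => hok x hx.1 hxY hx.2.2, hx.2.1⟩
  have := hits_eq hY
  have := Finset.card_filter_add_card_filter_not (s := Y) (fun x => P.hit x)
  rw [price]
  omega

lemma exists_isBest : ∃ h, P.IsBest h := by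
  classical
  have hne : ((Finset.range (P.block.card + 1)).filter P.Attainable).Nonempty := by
    have hall : P.Feasible P.block := fun x hx hx' => absurd hx hx'
    have := hall.attainable subset_rfl
    exact ⟨_, Finset.mem_filter.2 ⟨Finset.mem_range_succ_iff.2 this.2, this⟩⟩
  obtain ⟨h, hh, hmin⟩ :=
    Finset.exists_min_image _ (fun h => toLex (P.price h, OrderDual.toDual h)) hne
  refine ⟨h, (Finset.mem_filter.1 hh).2, fun h' hh' => ?_⟩
  have hle := hmin h' (Finset.mem_filter.2 ⟨Finset.mem_range_succ_iff.2 hh'.2, hh'⟩)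
  simpa only [Prod.Lex.toLex_le_toLex, OrderDual.toDual_le_toDual] using hle

end

section

variable {α : Type*} [LinearOrder α] (P : BlockProblem α)

open Classical in
/-- The choice for which `h` vertices are hit: the vertices that are short, and as many of the
others that are not yet hit as are missing, taken in increasing order. -/
noncomputable def chosen (h : ℕ) : Finset α :=
  P.block.filter fun x => P.Short h x ∨ (¬ P.hit x ∧
    (P.block.filter fun y => (¬ P.hit y ∧ ¬ P.Short h y) ∧ y < x).card + P.freshCount h +
      P.hitCount < h)

variable {P} {h : ℕ}

open Classical in
lemma mem_chosen {x : α} : x ∈ P.chosen h ↔ x ∈ P.block ∧ (P.Short h x ∨ (¬ P.hit x ∧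
    (P.block.filter fun y => (¬ P.hit y ∧ ¬ P.Short h y) ∧ y < x).card + P.freshCount h +
      P.hitCount < h)) := by
  simp only [chosen, Finset.mem_filter]

lemma chosen_subset : P.chosen h ⊆ P.block := fun _ hx => (mem_chosen.1 hx).1

lemma Attainable.hits_chosen (hh : P.Attainable h) : P.hits (P.chosen h) = h := by
  classical
  set A := P.block.filter fun y => ¬ P.hit y ∧ ¬ P.Short h y with hA
  have hcard : P.hitCount + P.freshCount h + A.card = P.block.card := by
    have hsplit := Finset.card_filter_add_card_filter_not (s := P.block) (fun x => P.hit x)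
    have hsplit' := Finset.card_filter_add_card_filter_not
      (s := P.block.filter fun x => ¬ P.hit x) (fun x => P.Short h x)
    rw [Finset.filter_filter, Finset.filter_filter] at hsplit'
    rw [hitCount, freshCount, hA]
    omega
  have hfresh : ((P.chosen h).filter fun x => ¬ P.hit x) =
      (P.block.filter fun x => ¬ P.hit x ∧ P.Short h x) ∪
        A.filter fun x => (A.filter fun y => y < x).card < h - P.hitCount - P.freshCount h := by
    ext x
    simp only [mem_chosen, hA, Finset.mem_filter, Finset.mem_union, Finset.filter_filter,
      Nat.lt_sub_iff_add_lt]
    tauto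
  rw [hits_eq chosen_subset, hfresh, Finset.card_union_of_disjoint, card_filter_card_lt]
  · have := hh.1
    have := hh.2
    rw [freshCount] at *
    omega
  · simp only [Finset.disjoint_left, hA, Finset.mem_filter]
    tauto

lemma Attainable.feasible_chosen (hh : P.Attainable h) : P.Feasible (P.chosen h) :=
  fun _ hx hx' hs => hx' (mem_chosen.2 ⟨hx, .inl (hh.hits_chosen ▸ hs)⟩)

lemma Attainable.card_chosen (hh : P.Attainable h) :
    (P.chosen h).card + P.hitCount = P.price h := by
  classical
  have hold : ((P.chosen h).filter fun x => P.hit x) =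
      P.block.filter fun x => P.hit x ∧ P.Short h x := by
    ext x
    simp only [mem_chosen, Finset.mem_filter]
    tauto
  have hsplit := Finset.card_filter_add_card_filter_not (s := P.chosen h) (fun x => P.hit x)
  rw [hold] at hsplit
  have := hits_eq (P := P) (chosen_subset (h := h))
  rw [hh.hits_chosen] at this
  rw [price]
  omega

lemma IsBest.isOptimal_chosen (hh : P.IsBest h) : P.IsOptimal (P.chosen h) := by
  refine ⟨chosen_subset, hh.1.feasible_chosen, fun Y hY hok => ?_⟩
  have := hh.1.card_chosen
  have := hok.price_le hY
  have := hh.2 _ (hok.attainable hY)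
  rw [hh.1.hits_chosen]
  omega

end

end BlockProblem

end VectorConnectivity

/-! ### Exchanging the part of a solution in one block -/

namespace VectorConnectivity

open SimpleGraph

section

variable {V : Type*} {G : SimpleGraph V} {ρ p u v w x : V} {F A A' : Set V} {S T X : Finset V}

/-- `p` is a neighbour of `v` that is closer to `ρ`. In a block graph there is at most one. -/
def IsParent (G : SimpleGraph V) (ρ p v : V) : Prop := G.Adj p v ∧ G.dist ρ v = G.dist ρ p + 1

lemma IsParent.reachable (h : IsParent G ρ p v) (hv : G.Reachable ρ v) : G.Reachable ρ p :=
  hv.trans h.1.symm.reachable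

lemma IsParent.btw (h : IsParent G ρ p v) (hv : G.Reachable ρ v) : Btw G ρ p v :=
  ⟨h.reachable hv, h.1.reachable, by rw [dist_eq_one_iff_adj.2 h.1, h.2]⟩

lemma isParent_of_btw (h : Btw G ρ p v) (hpv : G.Adj p v) : IsParent G ρ p v :=
  ⟨hpv, by rw [← h.dist_eq, dist_eq_one_iff_adj.2 hpv]⟩

lemma exists_isParent_btw (h : Btw G ρ u v) (huv : u ≠ v) :
    ∃ p, IsParent G ρ p v ∧ Btw G ρ u p := by
  obtain ⟨p, hvp, hp⟩ := exists_adj_btw h.right.symm huv.symm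
  have hpv : Btw G ρ p v := (hp.trans h.symm).symm
  refine ⟨p, isParent_of_btw hpv hvp.symm, h.left, hp.right.symm, ?_⟩
  have := h.dist_eq
  have := hpv.dist_eq
  have := hp.symm.dist_eq
  omega

lemma IsBlockGraph.isParent_unique [Finite V] (hG : IsBlockGraph G) (hv : G.Reachable ρ v)
    (hp : IsParent G ρ p v) (hu : IsParent G ρ u v) : p = u :=
  hG.btw_unique (hp.btw hv) (hu.btw hv) (Nat.succ_injective (hp.2.symm.trans hu.2))

lemma IsBlockGraph.isParent_of_sib [Finite V] (hG : IsBlockGraph G) (hv : G.Reachable ρ v)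
    (hp : IsParent G ρ p v) (hu : Sib G ρ v u) : IsParent G ρ p u := by
  obtain ⟨q, hq⟩ := exists_walk_btw (hu.reachable hv)
  obtain rfl | ⟨hvu, hd⟩ := hu
  · exact hp
  have hpq := hG.mem_support_of_btw (hp.btw hv) (q.concat hvu.symm)
  rw [Walk.support_concat, List.mem_append, List.mem_singleton, or_iff_left hp.1.ne] at hpq
  have hb := hq p hpq
  refine isParent_of_btw hb (dist_eq_one_iff_adj.1 ?_)
  have := hb.dist_eq
  have := hp.2
  omega

lemma IsBlockGraph.eq_parent [Finite V] (hG : IsBlockGraph G) (hv : G.Reachable ρ v)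
    (hp : IsParent G ρ p v) (hx : Sib G ρ v x) (hu : ¬ Sib G ρ v u) (hux : G.Adj u x)
    (hle : G.dist ρ u ≤ G.dist ρ x) : u = p := by
  have hxr := hx.reachable hv
  have hne : G.dist ρ u ≠ G.dist ρ x := fun h =>
    hu (hG.sib_trans hxr hx.symm (.inr ⟨hux.symm, h⟩))
  have := dist_le_succ_of_adj (a := ρ) hux
  exact hG.isParent_unique hxr ⟨hux, by omega⟩ (hG.isParent_of_sib hv hp hx)

/-- Outside the block of `v` nothing is lost if the vertices of `A` in the block are replaced by
the parent of `v` or by other vertices of the block. -/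
lemma Hit.of_exchange [Finite V] (hG : IsBlockGraph G) (hv : G.Reachable ρ v)
    (hp : IsParent G ρ p v) (hu : ¬ Sib G ρ v u) (hout : ∀ x ∈ A, ¬ Sib G ρ v x → x ∈ A')
    (hin : (∃ x ∈ A, Sib G ρ v x) → p ∈ A' ∨ ∃ x ∈ A', Sib G ρ v x) (h : Hit G ρ A u) :
    Hit G ρ A' u := by
  obtain ⟨w, hw, hb⟩ := h
  by_cases hvw : Sib G ρ v w
  · obtain ⟨z, hz, huz⟩ := exists_isParent_btw hb fun h => hu (h ▸ hvw)
    obtain rfl : z = p :=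
      hG.isParent_unique (hvw.reachable hv) hz (hG.isParent_of_sib hv hp hvw)
    obtain hz | ⟨x, hx, hvx⟩ := hin ⟨w, hw, hvw⟩
    · exact ⟨z, hz, huz⟩
    · exact ⟨x, hx, huz.trans ((hG.isParent_of_sib hv hp hvx).btw (hvx.reachable hv))⟩
  · exact ⟨w, hout w hw hvw, hb⟩

/-- `T` agrees with `S` farther from `ρ` than `v` and with `X` on the block of `v`, a block in
which `S` has no vertex. -/
structure Agrees (G : SimpleGraph V) (ρ v : V) (S X T : Finset V) : Prop where
  beyond : ∀ x, G.Reachable ρ x → G.dist ρ v < G.dist ρ x → (x ∈ T ↔ x ∈ S)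
  block : ∀ x, Sib G ρ v x → (x ∈ T ↔ x ∈ X)
  disjoint : ∀ x, Sib G ρ v x → x ∉ S

lemma Agrees.hit_iff_of_dist_lt (h : Agrees G ρ v S X T) (hu : G.dist ρ v < G.dist ρ u) :
    Hit G ρ (T ∪ F) u ↔ Hit G ρ (S ∪ F) u := by
  refine exists_congr fun w => and_congr_left fun hb => or_congr_left
    (h.beyond w hb.reachable ?_)
  have := hb.dist_eq
  omega

lemma Agrees.hit_iff (h : Agrees G ρ v S X T) (hv : G.Reachable ρ v) (hu : Sib G ρ v u) :
    Hit G ρ (T ∪ F) u ↔ Hit G ρ (S ∪ F) u ∨ u ∈ X := by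
  have hiff : ∀ w, Btw G ρ u w → (w ∈ T ↔ w ∈ S ∨ (w = u ∧ u ∈ X)) := by
    intro w hb
    by_cases hwu : w = u
    · simp [hwu, h.block u hu, h.disjoint u hu]
    · simp [hwu, h.beyond w hb.reachable (hu.dist_eq ▸ hb.dist_lt (Ne.symm hwu))]
  constructor
  · rintro ⟨w, hw | hw, hb⟩
    · exact ((hiff w hb).1 hw).imp (fun hw => ⟨w, .inl hw, hb⟩) And.right
    · exact .inl ⟨w, .inr hw, hb⟩
  · rintro (⟨w, hw, hb⟩ | hu')
    · exact ⟨w, hw.imp_left fun hw => (hiff w hb).2 (.inl hw), hb⟩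
    · exact ⟨u, .inl ((h.block u hu).2 hu'), .refl_right (hu.reachable hv)⟩

end

section

variable {V : Type*} [Fintype V] {G : SimpleGraph V} {ρ p u v x : V} {F D : Set V} {r : V → ℕ}
  {S T T' X Y : Finset V}

open Classical in
/-- `v` together with its neighbours at the same distance from `ρ`. In a block graph this is the
block that contains `v` and its parent, without the parent. -/
noncomputable def sibs (G : SimpleGraph V) (ρ v : V) : Finset V :=
  Finset.univ.filter fun u => Sib G ρ v u

lemma mem_sibs : u ∈ sibs G ρ v ↔ Sib G ρ v u := by simp [sibs]

open Classical in
/-- The choice in the block of `v` if `S` has been chosen farther from `ρ`. The `1` in the capacity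
of `u` is the direction of its parent. -/
noncomputable def blockProblem (G : SimpleGraph V) (ρ : V) (F : Set V) (r : V → ℕ)
    (S : Finset V) (v : V) : BlockProblem V where
  block := sibs G ρ v
  hit := Hit G ρ (S ∪ F)
  req := r
  cap u := 1 + (if u ∈ F then 1 else 0) + (hitKids G ρ (S ∪ F) u).card

/-- The requirements of `(G, F, r)` are met by `T` on the component of `ρ`, with directions counted
in place of paths: this is the same in block graphs, see `IsBlockGraph.isLinked_iff`. -/
def FeasibleOn (G : SimpleGraph V) (ρ : V) (F : Set V) (r : V → ℕ) (T : Finset V) : Prop :=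
  ∀ v, G.Reachable ρ v → v ∉ T → r v ≤ (dirs G v (T ∪ F)).card

/-- `T` is a vector connectivity set of the component of `ρ` that contains `ρ`. -/
structure RootedSolution (G : SimpleGraph V) (ρ : V) (F : Set V) (r : V → ℕ) (T : Finset V) :
    Prop where
  root_mem : ρ ∈ T
  reachable : ∀ x ∈ T, G.Reachable ρ x
  feasible : FeasibleOn G ρ F r T

open Classical in
lemma blockProblem_short_iff {h : ℕ} : (blockProblem G ρ F r S v).Short h u ↔
    h + (1 + (if u ∈ F then 1 else 0) + (hitKids G ρ (S ∪ F) u).card) <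
      r u + if Hit G ρ (S ∪ F) u then 1 else 0 := Iff.rfl

open Classical in
lemma Agrees.hits_eq (h : Agrees G ρ v S X T) (hv : G.Reachable ρ v) :
    (blockProblem G ρ F r S v).hits X = ((sibs G ρ v).filter fun x => Hit G ρ (T ∪ F) x).card := by
  rw [BlockProblem.hits]
  exact congrArg _ (Finset.filter_congr fun x hx => (h.hit_iff hv (mem_sibs.1 hx)).symm)

open Classical in
lemma IsBlockGraph.card_hitNb (hG : IsBlockGraph G) (h : Agrees G ρ v S X T)
    (hv : G.Reachable ρ v) (hu : Sib G ρ v u) :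
    (hitNb G ρ (T ∪ F) u).card + (if Hit G ρ (T ∪ F) u then 1 else 0) =
      (hitKids G ρ (S ∪ F) u).card + (blockProblem G ρ F r S v).hits X := by
  set B := (sibs G ρ v).filter fun x => Hit G ρ (T ∪ F) x with hB
  have hmemB : ∀ x, x ∈ B ↔ Sib G ρ v x ∧ Hit G ρ (T ∪ F) x := by simp [hB, mem_sibs]
  have hdist := hu.dist_eq
  have hunion : hitNb G ρ (T ∪ F) u = hitKids G ρ (S ∪ F) u ∪ B.erase u := by
    ext x
    simp only [mem_hitNb, Finset.mem_union, mem_hitKids, Finset.mem_erase, hmemB]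
    constructor
    · rintro ⟨hux, hle, hx⟩
      have hlt := dist_le_succ_of_adj (a := ρ) hux
      obtain heq | heq : G.dist ρ x = G.dist ρ u ∨ G.dist ρ x = G.dist ρ u + 1 := by omega
      · exact .inr ⟨hux.ne', hG.sib_trans (hu.reachable hv) hu.symm (.inr ⟨hux, heq⟩), hx⟩
      · exact .inl ⟨hux, heq, (h.hit_iff_of_dist_lt (by omega)).1 hx⟩
    · rintro (⟨hux, heq, hx⟩ | ⟨hne, hvx, hx⟩)
      · exact ⟨hux, by omega, (h.hit_iff_of_dist_lt (by omega)).2 hx⟩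
      · have hux := (hG.sib_trans hv hu hvx).resolve_left hne
        exact ⟨hux.1, hux.2.ge, hx⟩
  have hdisj : Disjoint (hitKids G ρ (S ∪ F) u) (B.erase u) := by
    refine Finset.disjoint_left.2 fun x hx hx' => ?_
    have := (mem_hitKids.1 hx).2.1
    have := ((hmemB x).1 (Finset.mem_of_mem_erase hx')).1.dist_eq
    omega
  rw [hunion, Finset.card_union_of_disjoint hdisj, h.hits_eq hv, ← hB, add_assoc]
  congr 1
  split_ifs with huT
  · exact Finset.card_erase_add_one ((hmemB u).2 ⟨hu, huT⟩)
  · rw [Finset.erase_eq_of_notMem fun h => huT ((hmemB u).1 h).2, add_zero]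

open Classical in
lemma IsBlockGraph.le_card_dirs_iff (hG : IsBlockGraph G) (h : Agrees G ρ v S X T)
    (hv : G.Reachable ρ v) (hvρ : v ≠ ρ) (hρ : ρ ∈ T) (hu : Sib G ρ v u) (huT : u ∉ T) :
    r u ≤ (dirs G u (T ∪ F)).card ↔
      ¬ (blockProblem G ρ F r S v).Short ((blockProblem G ρ F r S v).hits X) u := by
  have hdirs := hG.card_dirs (T := (T : Set V) ∪ F) (hu.reachable hv) (hu.ne hv hvρ) (.inl hρ)
  have hcard := hG.card_hitNb (F := F) (r := r) h hv hu
  have hhit : Hit G ρ (T ∪ F) u ↔ Hit G ρ (S ∪ F) u := by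
    rw [h.hit_iff hv hu, or_iff_left fun hX => huT ((h.block u hu).2 hX)]
  have hmem : u ∈ (T : Set V) ∪ F ↔ u ∈ F := or_iff_right huT
  simp only [hmem] at hdirs
  simp only [hhit] at hcard
  rw [blockProblem_short_iff]
  omega

lemma IsBlockGraph.card_hitNb_le (hG : IsBlockGraph G) (hT : Agrees G ρ v S Y T)
    (hT' : Agrees G ρ v S X T') (hv : G.Reachable ρ v) (hp : IsParent G ρ p v)
    (hu : ¬ Sib G ρ v u) (huT' : u ∉ T') (hout : ∀ x ∈ T, ¬ Sib G ρ v x → x ∈ T')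
    (hin : p ∈ T' ∨ (Y.Nonempty → ∃ x ∈ X, Sib G ρ v x) ∧
      (blockProblem G ρ F r S v).hits Y ≤ (blockProblem G ρ F r S v).hits X) :
    (hitNb G ρ (T ∪ F) u).card ≤ (hitNb G ρ (T' ∪ F) u).card := by
  classical
  have hhit : ∀ x, ¬ Sib G ρ v x → Hit G ρ (T ∪ F) x → Hit G ρ (T' ∪ F) x := fun x hx =>
    Hit.of_exchange hG hv hp hx (fun y hy hvy => hy.imp_left fun hy => hout y hy hvy) <| by
      rintro ⟨y, hy | hy, hvy⟩
      · refine hin.imp .inl fun h => ?_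
        obtain ⟨x, hx, hvx⟩ := h.1 ⟨y, (hT.block y hvy).1 hy⟩
        exact ⟨x, .inl ((hT'.block x hvx).2 hx), hvx⟩
      · exact .inr ⟨y, .inr hy, hvy⟩
  by_cases hup : u = p
  · subst hup
    have hblock : ∀ R : Finset V, (hitNb G ρ (R ∪ F) u).filter (Sib G ρ v) =
        (sibs G ρ v).filter fun x => Hit G ρ (R ∪ F) x := by
      intro R
      ext x
      simp only [Finset.mem_filter, mem_hitNb, mem_sibs]
      refine ⟨fun h => ⟨h.2, h.1.2.2⟩, fun h => ?_⟩
      have hx := hG.isParent_of_sib hv hp h.1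
      exact ⟨⟨hx.1, by have := hx.2; omega, h.2⟩, h.1⟩
    have hle := (hin.resolve_left huT').2
    rw [hT.hits_eq hv, hT'.hits_eq hv] at hle
    rw [← Finset.card_filter_add_card_filter_not (s := hitNb G ρ (T ∪ F) u) (Sib G ρ v),
      ← Finset.card_filter_add_card_filter_not (s := hitNb G ρ (T' ∪ F) u) (Sib G ρ v),
      hblock, hblock]
    refine Nat.add_le_add (by convert hle) (Finset.card_le_card fun x hx => ?_)
    simp only [Finset.mem_filter, mem_hitNb] at hx ⊢
    exact ⟨⟨hx.1.1, hx.1.2.1, hhit x hx.2 hx.1.2.2⟩, hx.2⟩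
  · refine Finset.card_le_card fun x hx => ?_
    rw [mem_hitNb] at hx ⊢
    exact ⟨hx.1, hx.2.1, hhit x (fun hvx => hup (hG.eq_parent hv hp hvx hu hx.1 hx.2.1)) hx.2.2⟩

lemma IsBlockGraph.rootedSolution_exchange (hG : IsBlockGraph G) (hT : RootedSolution G ρ F r T)
    (hY : Agrees G ρ v S Y T) (hX : Agrees G ρ v S X T') (hv : G.Reachable ρ v) (hvρ : v ≠ ρ)
    (hp : IsParent G ρ p v) (hXok : (blockProblem G ρ F r S v).Feasible X)
    (hr : ∀ x ∈ T', G.Reachable ρ x) (hout : ∀ x ∈ T, ¬ Sib G ρ v x → x ∈ T')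
    (hin : p ∈ T' ∨ (Y.Nonempty → ∃ x ∈ X, Sib G ρ v x) ∧
      (blockProblem G ρ F r S v).hits Y ≤ (blockProblem G ρ F r S v).hits X) :
    RootedSolution G ρ F r T' := by
  have hρ : ρ ∈ T' := hout ρ hT.root_mem fun h => h.ne hv hvρ rfl
  refine ⟨hρ, hr, fun u hu huT' => ?_⟩
  by_cases hvu : Sib G ρ v u
  · exact (hG.le_card_dirs_iff hX hv hvρ hρ hvu huT').2
      (hXok u (mem_sibs.2 hvu) fun h => huT' ((hX.block u hvu).2 h))
  have huT : u ∉ T := fun h => huT' (hout u h hvu)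
  have huρ : u ≠ ρ := ne_of_mem_of_not_mem hρ huT' |>.symm
  refine (hT.feasible u hu huT).trans ?_
  rw [hG.card_dirs hu huρ (.inl hT.root_mem), hG.card_dirs hu huρ (.inl hρ)]
  have hF : u ∈ (T : Set V) ∪ F ↔ u ∈ F := by simp [huT]
  have hF' : u ∈ (T' : Set V) ∪ F ↔ u ∈ F := by simp [huT']
  classical
  simp only [hF, hF']
  exact Nat.add_le_add_left (hG.card_hitNb_le hY hX hv hp hvu huT' hout hin) _

open Classical in
/-- `T` with its part in the block of `v` replaced by `X`, and with the parent `p` added if `X` is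
smaller than that part. -/
noncomputable def replaceBlock (G : SimpleGraph V) (ρ v p : V) (T X : Finset V) : Finset V :=
  (T \ sibs G ρ v) ∪ X ∪ if X.card < (T ∩ sibs G ρ v).card then {p} else ∅

open Classical in
lemma mem_replaceBlock : x ∈ replaceBlock G ρ v p T X ↔
    (x ∈ T ∧ ¬ Sib G ρ v x) ∨ x ∈ X ∨ (X.card < (T ∩ sibs G ρ v).card ∧ x = p) := by
  rw [replaceBlock]
  split_ifs with h <;> simp only [h, Finset.mem_union, Finset.mem_sdiff, mem_sibs,
    Finset.mem_singleton, Finset.notMem_empty, true_and, false_and, or_assoc]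

open Classical in
lemma card_replaceBlock_le (h : X.card ≤ (T ∩ sibs G ρ v).card) :
    (replaceBlock G ρ v p T X).card ≤ T.card := by
  have hsplit := Finset.card_sdiff_add_card_inter T (sibs G ρ v)
  have hunion := Finset.card_union_le (T \ sibs G ρ v) X
  rw [replaceBlock]
  split_ifs with hlt
  · have := Finset.card_union_le ((T \ sibs G ρ v) ∪ X) {p}
    rw [Finset.card_singleton] at this
    omega
  · rw [Finset.union_empty]
    omega

lemma agrees_replaceBlock (hp : IsParent G ρ p v) (hS : ∀ x, Sib G ρ v x → x ∉ S)
    (hT : ∀ x, G.Reachable ρ x → G.dist ρ v < G.dist ρ x → (x ∈ T ↔ x ∈ S))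
    (hX : X ⊆ sibs G ρ v) : Agrees G ρ v S X (replaceBlock G ρ v p T X) where
  beyond x hx hlt := by
    have hvx : ¬ Sib G ρ v x := fun h => hlt.ne' h.dist_eq
    have hxp : x ≠ p := by rintro rfl; have := hp.2; omega
    have hxX : x ∉ X := fun h => hvx (mem_sibs.1 (hX h))
    simp [mem_replaceBlock, hvx, hxp, hxX, hT x hx hlt]
  block x hvx := by
    have hxp : x ≠ p := by rintro rfl; have := hp.2; have := hvx.dist_eq; omega
    simp [mem_replaceBlock, hvx, hxp]
  disjoint := hS

/-- An optimal choice in one block can be built into every solution that agrees with the choices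
made in the vertices `D` treated before. -/
lemma IsBlockGraph.exchange (hG : IsBlockGraph G) (hv : G.Reachable ρ v) (hvρ : v ≠ ρ)
    (hdeep : ∀ x, G.Reachable ρ x → G.dist ρ v < G.dist ρ x → x ∈ D)
    (hhigh : ∀ x ∈ D, G.dist ρ v ≤ G.dist ρ x) (hdisj : ∀ x ∈ D, ¬ Sib G ρ v x)
    (hS : ∀ x, x ∈ S ↔ x ∈ T ∧ x ∈ D) (hT : RootedSolution G ρ F r T)
    (hX : (blockProblem G ρ F r S v).IsOptimal X) :
    ∃ T', RootedSolution G ρ F r T' ∧ T'.card ≤ T.card ∧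
      ∀ x, x ∈ S ∨ x ∈ X ↔ x ∈ T' ∧ (x ∈ D ∨ Sib G ρ v x) := by
  classical
  obtain ⟨hXK, hXok, hXopt⟩ := hX
  obtain ⟨p, hp, -⟩ := exists_isParent_btw (Btw.refl_right hv.symm).symm hvρ.symm
  have hSK : ∀ x, Sib G ρ v x → x ∉ S := fun x hvx h => hdisj x ((hS x).1 h).2 hvx
  have hTS : ∀ x, G.Reachable ρ x → G.dist ρ v < G.dist ρ x → (x ∈ T ↔ x ∈ S) := fun x hx h => by
    simp [hS, hdeep x hx h]
  have hY : Agrees G ρ v S (T ∩ sibs G ρ v) T := ⟨hTS, fun x hx => by simp [mem_sibs, hx], hSK⟩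
  have hYok : (blockProblem G ρ F r S v).Feasible (T ∩ sibs G ρ v) := by
    intro u hu huY
    have hvu := mem_sibs.1 hu
    have huT : u ∉ T := fun h => huY (Finset.mem_inter.2 ⟨h, hu⟩)
    exact (hG.le_card_dirs_iff hY hv hvρ hT.root_mem hvu huT).1
      (hT.feasible u (hvu.reachable hv) huT)
  obtain ⟨hcard, hhits⟩ := hXopt _ Finset.inter_subset_right hYok
  have hX := agrees_replaceBlock hp hSK hTS hXK
  refine ⟨replaceBlock G ρ v p T X, hG.rootedSolution_exchange hT hY hX hv hvρ hp hXok ?_ ?_ ?_,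
    card_replaceBlock_le hcard, fun x => ?_⟩
  · intro x hx
    obtain h | h | ⟨-, rfl⟩ := mem_replaceBlock.1 hx
    exacts [hT.reachable x h.1, (mem_sibs.1 (hXK h)).reachable hv, hp.reachable hv]
  · exact fun x hx hvx => mem_replaceBlock.2 (.inl ⟨hx, hvx⟩)
  · obtain hlt | heq := hcard.lt_or_eq
    · exact .inl (mem_replaceBlock.2 (.inr (.inr ⟨hlt, rfl⟩)))
    · refine .inr ⟨fun hne => ?_, hhits heq⟩
      obtain ⟨x, hx⟩ := Finset.card_pos.1 (heq ▸ hne.card_pos)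
      exact ⟨x, hx, mem_sibs.1 (hXK hx)⟩
  · by_cases hvx : Sib G ρ v x
    · simp [hvx, hSK x hvx, hX.block x hvx]
    · have hxX : x ∉ X := fun h => hvx (mem_sibs.1 (hXK h))
      have hpD : p ∉ D := fun h => by have := hhigh p h; have := hp.2; omega
      simp only [hS, mem_replaceBlock, hvx, hxX, not_false_eq_true, and_true, or_false, false_or]
      refine and_congr_left fun hxD => (or_iff_left ?_).symm
      rintro ⟨-, rfl⟩
      exact hpD hxD

end

end VectorConnectivity

/-! ### Computing reachability and distances -/

namespace VectorConnectivity

open SimpleGraph RAM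

/-- One round of breadth-first search from all vertices: matrix `1` tells which vertices have been
reached, and matrix `2` counts the rounds at the start of which they had not. -/
def distanceRound : Stmt :=
  .seq (.mat 2 (.add (.get2 2 1 0) (.ind (.not (.get2 1 1 0)))))
    (.mat 1 (.or (.get2 1 1 0) (.ex 3 (.and (.get2 1 1 3) (.get2 0 3 0)))))

/-- Breadth-first search, which makes matrix `1` the reachability relation and matrix `2` the
distance. -/
def distances : Stmt :=
  .seq (.mat 1 (.ind (.eq (.idx 1) (.idx 0)))) (.loop 2 distanceRound)

variable {n : ℕ} {G : SimpleGraph (Fin n)} {F : Set (Fin n)} {r : Fin n → ℕ} {σ τ : Mem n}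

/-- The memory holds the instance `(G, F, r)` together with reachability and distances. -/
structure Data (G : SimpleGraph (Fin n)) (F : Set (Fin n)) (r : Fin n → ℕ) (σ : Mem n) :
    Prop where
  req : σ.one 0 = r
  free : ∀ v, σ.one 2 v ≠ 0 ↔ v ∈ F
  adj : ∀ u v, σ.two 0 u v ≠ 0 ↔ G.Adj u v
  reach : ∀ u v, σ.two 1 u v ≠ 0 ↔ G.Reachable u v
  dist : ∀ u v, G.Reachable u v → σ.two 2 u v = G.dist u v

lemma Data.congr (h : Data G F r σ) (h0 : τ.one 0 = σ.one 0) (h2 : τ.one 2 = σ.one 2)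
    (ht : τ.two = σ.two) : Data G F r τ :=
  ⟨h0 ▸ h.req, h2 ▸ h.free, ht ▸ h.adj, ht ▸ h.reach, ht ▸ h.dist⟩

lemma dist_lt_of_reachable {V : Type*} [Fintype V] {G : SimpleGraph V} {u v : V}
    (h : G.Reachable u v) : G.dist u v < Fintype.card V := by
  obtain ⟨p, hp, hl⟩ := h.exists_path_of_dist
  exact hl ▸ hp.length_lt

lemma reachable_and_dist_le_succ {V : Type*} {G : SimpleGraph V} {u v : V} {k : ℕ} :
    G.Reachable u v ∧ G.dist u v ≤ k + 1 ↔ (G.Reachable u v ∧ G.dist u v ≤ k) ∨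
      ∃ w, (G.Reachable u w ∧ G.dist u w ≤ k) ∧ G.Adj w v := by
  constructor
  · rintro ⟨h, hk⟩
    obtain rfl | huv := eq_or_ne v u
    · exact .inl ⟨h, by simp⟩
    · obtain ⟨w, hw, hwu⟩ := exists_adj_btw h.symm huv
      have hdist := hwu.symm.dist_eq
      rw [dist_eq_one_iff_adj.2 hw.symm] at hdist
      exact .inr ⟨w, ⟨hwu.right.symm, by omega⟩, hw.symm⟩
  · rintro (⟨h, hk⟩ | ⟨w, ⟨h, hk⟩, hw⟩)
    · exact ⟨h, by omega⟩
    · exact ⟨h.trans hw.reachable, (dist_le_succ_of_adj hw).trans (by omega)⟩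

/-- The state of the breadth-first search after `k` rounds. -/
structure DistancesUpTo (G : SimpleGraph (Fin n)) (σ : Mem n) (k : ℕ) (τ : Mem n) : Prop where
  one : τ.one = σ.one
  adj : τ.two 0 = σ.two 0
  reach : ∀ u v, τ.two 1 u v ≠ 0 ↔ G.Reachable u v ∧ G.dist u v ≤ k
  dist : ∀ u v, G.Reachable u v → τ.two 2 u v = min k (G.dist u v)

lemma DistancesUpTo.succ {k : ℕ} {ρ : ℕ → Fin n} (hadj : ∀ u v, σ.two 0 u v ≠ 0 ↔ G.Adj u v)
    (h : DistancesUpTo G σ k τ) : DistancesUpTo G σ (k + 1) (distanceRound.exec ρ τ) where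
  one := h.one
  adj := by simp [distanceRound, Stmt.exec, h.adj]
  reach u v := by
    rw [reachable_and_dist_le_succ]
    simp only [distanceRound, Stmt.exec, Function.update_self]
    change Expr.IsTrue _ _ _ ↔ _
    simp [Expr.true_get2, h.adj, h.reach, hadj]
  dist u v huv := by
    simp [distanceRound, Stmt.exec, Expr.true_get2, h.reach, h.dist u v huv, huv]
    split_ifs <;> omega

lemma exec_distances (ρ : ℕ → Fin n) (hadj : ∀ u v, σ.two 0 u v ≠ 0 ↔ G.Adj u v)
    (h2 : ∀ u v, σ.two 2 u v = 0) : DistancesUpTo G σ n (distances.exec ρ σ) := by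
  refine fold_induction (DistancesUpTo G σ) ⟨rfl, by simp [Stmt.exec], fun u v => ?_,
    fun u v _ => by simp [Stmt.exec, h2]⟩ fun k hk τ h => h.succ hadj
  have hself : u = v → G.Reachable u v := by rintro rfl; rfl
  simp only [Stmt.exec, Function.update_self]
  change Expr.IsTrue _ _ _ ↔ _
  simpa [← Fin.ext_iff, and_or_left] using hself

lemma DistancesUpTo.data (h : DistancesUpTo G σ n τ) (hreq : σ.one 0 = r)
    (hfree : ∀ v, σ.one 2 v ≠ 0 ↔ v ∈ F) (hadj : ∀ u v, σ.two 0 u v ≠ 0 ↔ G.Adj u v) :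
    Data G F r τ where
  req := h.one ▸ hreq
  free := h.one ▸ hfree
  adj := h.adj ▸ hadj
  reach u v := (h.reach u v).trans <| and_iff_left_of_imp fun huv => by
    simpa using (dist_lt_of_reachable huv).le
  dist u v huv := by
    rw [h.dist u v huv, min_eq_right (by simpa using (dist_lt_of_reachable huv).le)]

end VectorConnectivity

/-! ### The choice in one block as a program -/

namespace VectorConnectivity

open SimpleGraph RAM

/-- The formula for `Btw`. -/
def btwE (a x b : ℕ) : Expr := .and (.and (.get2 1 a x) (.get2 1 x b))
  (.eq (.add (.get2 2 a x) (.get2 2 x b)) (.get2 2 a b))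

/-- Vector `4` becomes the set of vertices hit by the solution in vector `3` and the free vertices;
variable `10` is the root. -/
def hitStmt : Stmt := .vec 4 (.ex 5 (.and (.or (.get1 3 5) (.get1 2 5)) (btwE 10 0 5)))

/-- Vector `5` becomes the vector of the capacities in the block problems. -/
def capacityStmt : Stmt := .vec 5 (.add (.add (.num 1) (.ind (.get1 2 0)))
  (.count 1 (.and (.get2 0 0 1)
    (.and (.eq (.get2 2 10 1) (.add (.get2 2 10 0) (.num 1))) (.get1 4 1)))))

/-- Vector `6` becomes the block of variable `12` without its vertex closest to the root. -/
def blockStmt : Stmt := .vec 6 (.or (.eq (.idx 0) (.idx 12))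
  (.and (.get2 0 12 0) (.eq (.get2 2 10 0) (.get2 2 10 12))))

/-- The formula for `BlockProblem.Short`. -/
def shortE (x h : ℕ) : Expr :=
  .lt (.add (.idx h) (.get1 5 x)) (.add (.get1 0 x) (.ind (.get1 4 x)))

/-- The expression for `BlockProblem.hitCount`. -/
def hitCountE : Expr := .count 5 (.and (.get1 6 5) (.get1 4 5))

/-- The expression for `BlockProblem.freshCount`. -/
def freshCountE (h : ℕ) : Expr :=
  .count 5 (.and (.get1 6 5) (.and (.not (.get1 4 5)) (shortE 5 h)))

/-- The formula for `BlockProblem.Attainable`. -/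
def attainableE (h : ℕ) : Expr :=
  .and (.le (.add (freshCountE h) hitCountE) (.idx h)) (.le (.idx h) (.count 5 (.get1 6 5)))

/-- The expression for `BlockProblem.price`. -/
def priceE (h : ℕ) : Expr :=
  .add (.count 5 (.and (.get1 6 5) (.and (.get1 4 5) (shortE 5 h)))) (.idx h)

/-- The formula for `BlockProblem.IsBest`. -/
def isBestE (h : ℕ) : Expr :=
  .and (attainableE h) (.all 4 (.or (.not (attainableE 4)) (.or (.lt (priceE h) (priceE 4))
    (.and (.eq (priceE h) (priceE 4)) (.le (.idx 4) (.idx h))))))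

/-- The formula for membership in `BlockProblem.chosen`. -/
def chosenE (h x : ℕ) : Expr :=
  .and (.get1 6 x) (.or (shortE x h) (.and (.not (.get1 4 x))
    (.lt (.add (.add (.count 5 (.and (.get1 6 5)
      (.and (.and (.not (.get1 4 5)) (.not (shortE 5 h))) (.lt (.idx 5) (.idx x)))))
        (freshCountE h)) hitCountE) (.idx h))))

/-- The formula for `IsActive` at variable `12` in the round of variable `11`; vector `6` holds the
block. -/
def activeE : Expr :=
  .and (.get2 1 10 12) (.and (.not (.eq (.idx 12) (.idx 10)))
    (.and (.eq (.add (.add (.get2 2 10 12) (.idx 11)) (.num 1)) (.count 5 (.num 1)))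
      (.all 5 (.or (.not (.lt (.idx 5) (.idx 12))) (.not (.get1 6 5))))))

/-- Compute the block problem of variable `12`. -/
def prepareStmt : Stmt := .seq hitStmt (.seq capacityStmt blockStmt)

/-- Add an optimal choice in the block of variable `12` to the solution if that block is to be
treated now. -/
def chooseStmt : Stmt := .seq prepareStmt
  (.vec 3 (.or (.get1 3 0) (.and activeE (.ex 3 (.and (isBestE 3) (chosenE 3 0))))))

variable {n : ℕ}

section

variable {σ : Mem n} {ρ : ℕ → Fin n} {P : BlockProblem (Fin n)} {h x : ℕ}

/-- Vectors `0`, `4`, `5` and `6` hold a block problem. -/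
structure BlockData (σ : Mem n) (P : BlockProblem (Fin n)) : Prop where
  req : ∀ x, σ.one 0 x = P.req x
  hit : ∀ x, σ.one 4 x ≠ 0 ↔ P.hit x
  cap : ∀ x, σ.one 5 x = P.cap x
  block : ∀ x, σ.one 6 x ≠ 0 ↔ x ∈ P.block

namespace BlockData

lemma true_shortE (hσ : BlockData σ P) : Expr.IsTrue σ ρ (shortE x h) ↔ P.Short (ρ h) (ρ x) := by
  classical
  simp [shortE, Expr.true_get1, hσ.req, hσ.hit, hσ.cap, BlockProblem.Short]

lemma eval_count_block (hσ : BlockData σ P) {e : Expr} {Q : Fin n → Prop} {_ : DecidablePred Q}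
    (hQ : ∀ i, Expr.IsTrue σ (Function.update ρ x i) e ↔ Q i) :
    (Expr.count x (.and (.get1 6 x) e)).eval σ ρ = (P.block.filter Q).card := by
  rw [Expr.eval_count]
  congr 1
  ext i
  simp [Expr.true_get1, hσ.block, hQ]

lemma eval_hitCountE (hσ : BlockData σ P) : hitCountE.eval σ ρ = P.hitCount :=
  hσ.eval_count_block fun i => by simp [Expr.true_get1, hσ.hit]

lemma eval_freshCountE (hσ : BlockData σ P) (hh : h ≠ 5) :
    (freshCountE h).eval σ ρ = P.freshCount (ρ h) :=
  hσ.eval_count_block fun i => by simp [Expr.true_get1, hσ.hit, hσ.true_shortE, hh]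

lemma true_attainableE (hσ : BlockData σ P) (hh : h ≠ 5) :
    Expr.IsTrue σ ρ (attainableE h) ↔ P.Attainable (ρ h) := by
  simp [attainableE, hσ.eval_freshCountE hh, hσ.eval_hitCountE, Expr.true_get1, hσ.block,
    BlockProblem.Attainable]

lemma eval_priceE (hσ : BlockData σ P) (hh : h ≠ 5) : (priceE h).eval σ ρ = P.price (ρ h) :=
  congrArg (· + (ρ h : ℕ)) <|
    hσ.eval_count_block fun i => by simp [Expr.true_get1, hσ.hit, hσ.true_shortE, hh]

lemma true_isBestE (hσ : BlockData σ P) (hP : P.block.card < n) (hh : h ≠ 5) (hh' : h ≠ 4) :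
    Expr.IsTrue σ ρ (isBestE h) ↔ P.IsBest (ρ h) := by
  have hbound : ∀ Q : ℕ → Prop, (∀ i : Fin n, P.Attainable i → Q i) ↔ ∀ i, P.Attainable i → Q i :=
    fun Q => ⟨fun H i hi => H ⟨i, hi.2.trans_lt hP⟩ hi, fun H i => H i⟩
  rw [BlockProblem.IsBest, ← hbound]
  simp [isBestE, hσ.true_attainableE, hσ.eval_priceE, hh, hh', imp_iff_not_or]

lemma true_chosenE (hσ : BlockData σ P) (hh : h ≠ 5) (hx : x ≠ 5) :
    Expr.IsTrue σ ρ (chosenE h x) ↔ ρ x ∈ P.chosen (ρ h) := by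
  classical
  rw [BlockProblem.mem_chosen, chosenE, ← hσ.eval_count_block (ρ := ρ) (x := 5)
    (e := .and (.and (.not (.get1 4 5)) (.not (shortE 5 h))) (.lt (.idx 5) (.idx x)))
    fun i => by simp [Expr.true_get1, hσ.hit, hσ.true_shortE, hh, hx]]
  simp only [Expr.true_and, Expr.true_or, Expr.true_not, Expr.true_lt, Expr.true_get1,
    Expr.eval_add, Expr.eval_idx, hσ.block, hσ.hit, hσ.true_shortE, hσ.eval_freshCountE hh,
    hσ.eval_hitCountE]

end BlockData

end

section

variable {G : SimpleGraph (Fin n)} {F : Set (Fin n)} {r : Fin n → ℕ} {σ : Mem n} {ρ : ℕ → Fin n}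
  {a b x : ℕ}

open Classical in
/-- The set of vertices held by vector `a`. -/
noncomputable def support (σ : Mem n) (a : ℕ) : Finset (Fin n) :=
  Finset.univ.filter fun x => σ.one a x ≠ 0

lemma mem_support {x : Fin n} : x ∈ support σ a ↔ σ.one a x ≠ 0 := by simp [support]

/-- The block of `v` is to be treated in round `d`, and `v` is its first vertex. The rounds proceed
towards the root. -/
def IsActive (G : SimpleGraph (Fin n)) (ρ v : Fin n) (d : ℕ) : Prop :=
  G.Reachable ρ v ∧ v ≠ ρ ∧ G.dist ρ v + d + 1 = n ∧ ∀ u < v, ¬ Sib G ρ v u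

lemma card_sibs_lt {ρ v : Fin n} (hv : G.Reachable ρ v) (hvρ : v ≠ ρ) :
    (sibs G ρ v).card < n := by
  have hρ : ρ ∉ sibs G ρ v := fun h => (mem_sibs.1 h).ne hv hvρ rfl
  simpa using Finset.card_lt_univ_of_notMem hρ

lemma Data.true_btwE (hσ : Data G F r σ) :
    Expr.IsTrue σ ρ (btwE a x b) ↔ Btw G (ρ a) (ρ x) (ρ b) := by
  simp only [btwE, Expr.true_and, Expr.true_eq, Expr.true_get2, Expr.eval_add, Expr.eval_get2,
    hσ.reach]
  constructor
  · rintro ⟨⟨h, h'⟩, hd⟩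
    exact ⟨h, h', by rwa [hσ.dist _ _ h, hσ.dist _ _ h', hσ.dist _ _ (h.trans h')] at hd⟩
  · rintro ⟨h, h', hd⟩
    exact ⟨⟨h, h'⟩, by rwa [hσ.dist _ _ h, hσ.dist _ _ h', hσ.dist _ _ (h.trans h')]⟩

lemma Data.hitStmt_ne_zero (hσ : Data G F r σ) (x : Fin n) :
    (hitStmt.exec ρ σ).one 4 x ≠ 0 ↔ Hit G (ρ 10) (support σ 3 ∪ F) x := by
  simp only [hitStmt, Stmt.exec, Function.update_self]
  change Expr.IsTrue _ _ _ ↔ _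
  simp [Expr.true_get1, hσ.true_btwE, hσ.free, Hit, mem_support]

lemma Data.capacityStmt_eq (hσ : Data G F r σ) {S : Finset (Fin n)} {v : Fin n}
    (hS : ∀ x, σ.one 4 x ≠ 0 ↔ Hit G (ρ 10) (S ∪ F) x) (x : Fin n) :
    (capacityStmt.exec ρ σ).one 5 x = (blockProblem G (ρ 10) F r S v).cap x := by
  classical
  have hdist : ∀ u, G.Adj x u → Hit G (ρ 10) (S ∪ F) u →
      (σ.two 2 (ρ 10) u = σ.two 2 (ρ 10) x + 1 ↔ G.dist (ρ 10) u = G.dist (ρ 10) x + 1) := by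
    rintro u hxu ⟨w, -, hu⟩
    rw [hσ.dist _ _ hu.left, hσ.dist _ _ (hu.left.trans hxu.symm.reachable)]
  have hkids : Finset.univ.filter (fun u => G.Adj x u ∧ σ.two 2 (ρ 10) u = σ.two 2 (ρ 10) x + 1 ∧
      Hit G (ρ 10) (S ∪ F) u) = hitKids G (ρ 10) (S ∪ F) x := by
    ext u
    simp only [Finset.mem_filter, Finset.mem_univ, true_and, mem_hitKids]
    exact and_congr_right fun hxu => and_congr_left (hdist u hxu)
  simp [capacityStmt, Stmt.exec, Expr.true_get1, Expr.true_get2, hσ.free, hσ.adj, hS, hkids,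
    blockProblem]

lemma Data.blockStmt_ne_zero (hσ : Data G F r σ) (hρ : G.Reachable (ρ 10) (ρ 12)) (x : Fin n) :
    (blockStmt.exec ρ σ).one 6 x ≠ 0 ↔ x ∈ sibs G (ρ 10) (ρ 12) := by
  have hdist : G.Adj (ρ 12) x →
      (σ.two 2 (ρ 10) x = σ.two 2 (ρ 10) (ρ 12) ↔ G.dist (ρ 10) x = G.dist (ρ 10) (ρ 12)) :=
    fun hx => by rw [hσ.dist _ _ hρ, hσ.dist _ _ (hρ.trans hx.reachable)]
  simp only [blockStmt, Stmt.exec, Function.update_self]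
  change Expr.IsTrue _ _ _ ↔ _
  simpa [Expr.true_get2, hσ.adj, ← Fin.ext_iff, mem_sibs, Sib] using
    or_congr_right (and_congr_right hdist)

lemma Data.exec_prepareStmt (hσ : Data G F r σ) : Data G F r (prepareStmt.exec ρ σ) ∧
    (∀ b < 4, (prepareStmt.exec ρ σ).one b = σ.one b) ∧
    (G.Reachable (ρ 10) (ρ 12) → BlockData (prepareStmt.exec ρ σ)
      (blockProblem G (ρ 10) F r (support σ 3) (ρ 12))) := by
  have hone : ∀ b < 4, (prepareStmt.exec ρ σ).one b = σ.one b := fun b hb => by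
    simp [prepareStmt, hitStmt, capacityStmt, blockStmt, Stmt.exec, show b ≠ 4 by omega,
      show b ≠ 5 by omega, show b ≠ 6 by omega]
  have hhit : Data G F r (hitStmt.exec ρ σ) := hσ.congr rfl rfl rfl
  have hcap : Data G F r (capacityStmt.exec ρ (hitStmt.exec ρ σ)) := hhit.congr rfl rfl rfl
  exact ⟨hσ.congr (hone 0 (by simp)) (hone 2 (by simp)) rfl, hone, fun hρ =>
    { req := fun x => by rw [hone 0 (by simp), hσ.req]; rfl
      hit := hσ.hitStmt_ne_zero
      cap := hhit.capacityStmt_eq hσ.hitStmt_ne_zero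
      block := hcap.blockStmt_ne_zero hρ }⟩

lemma Data.true_activeE (hσ : Data G F r σ)
    (hblock : G.Reachable (ρ 10) (ρ 12) → ∀ x, σ.one 6 x ≠ 0 ↔ x ∈ sibs G (ρ 10) (ρ 12)) :
    Expr.IsTrue σ ρ activeE ↔ IsActive G (ρ 10) (ρ 12) (ρ 11) := by
  classical
  have hone : (Expr.count 5 (.num 1)).eval σ ρ = n := by simp
  simp only [activeE, Expr.true_and, Expr.true_not, Expr.true_eq, Expr.true_all, Expr.true_or,
    Expr.true_lt, Expr.true_get1, Expr.true_get2, Expr.eval_add, Expr.eval_idx, Expr.eval_get2,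
    Expr.eval_num, hone, hσ.reach, IsActive]
  refine and_congr_right fun hρ => ?_
  simp [hσ.dist _ _ hρ, hblock hρ, mem_sibs, Fin.ext_iff, or_iff_not_imp_left]

lemma Data.chooseStmt_ne_zero (hσ : Data G F r σ) (x : Fin n) :
    (chooseStmt.exec ρ σ).one 3 x ≠ 0 ↔ x ∈ support σ 3 ∨
      (IsActive G (ρ 10) (ρ 12) (ρ 11) ∧ ∃ h : Fin n,
        (blockProblem G (ρ 10) F r (support σ 3) (ρ 12)).IsBest h ∧
          x ∈ (blockProblem G (ρ 10) F r (support σ 3) (ρ 12)).chosen h) := by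
  obtain ⟨hdata, hone, hblock⟩ := hσ.exec_prepareStmt (ρ := ρ)
  rw [chooseStmt, Stmt.exec]
  set σ' := prepareStmt.exec ρ σ
  have hactive : Expr.IsTrue σ' (Function.update ρ 0 x) activeE ↔
      IsActive G (ρ 10) (ρ 12) (ρ 11) := hdata.true_activeE fun hρ => (hblock hρ).block
  simp only [Stmt.exec, Function.update_self]
  change Expr.IsTrue _ _ _ ↔ _
  rw [Expr.true_or, Expr.true_and, hactive, Expr.true_get1, hone 3 (by simp), mem_support,
    Function.update_self]
  refine or_congr_right (and_congr_right fun hv => ?_)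
  simp [(hblock hv.1).true_isBestE (card_sibs_lt hv.1 hv.2.1), (hblock hv.1).true_chosenE]

lemma Data.exec_chooseStmt (hσ : Data G F r σ) :
    Data G F r (chooseStmt.exec ρ σ) ∧ (chooseStmt.exec ρ σ).one 1 = σ.one 1 ∧
    (¬ IsActive G (ρ 10) (ρ 12) (ρ 11) → support (chooseStmt.exec ρ σ) 3 = support σ 3) ∧
    (IsActive G (ρ 10) (ρ 12) (ρ 11) → ∃ X,
      (blockProblem G (ρ 10) F r (support σ 3) (ρ 12)).IsOptimal X ∧
        support (chooseStmt.exec ρ σ) 3 = support σ 3 ∪ X) := by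
  obtain ⟨-, hone, -⟩ := hσ.exec_prepareStmt (ρ := ρ)
  have hne : ∀ b < 3, (chooseStmt.exec ρ σ).one b = σ.one b := fun b hb => by
    simp [chooseStmt, Stmt.exec, hone b (by omega), hb.ne]
  have hsupp := fun x => mem_support.trans (hσ.chooseStmt_ne_zero (ρ := ρ) x)
  refine ⟨hσ.congr (hne 0 (by simp)) (hne 2 (by simp)) rfl, hne 1 (by simp), fun hv => ?_,
    fun hv => ?_⟩
  · ext x
    simp [hsupp, hv]
  · obtain ⟨h, hbest⟩ := (blockProblem G (ρ 10) F r (support σ 3) (ρ 12)).exists_isBest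
    have hlt := hbest.le_card.trans_lt (card_sibs_lt hv.1 hv.2.1)
    refine ⟨_, hbest.isOptimal_chosen, ?_⟩
    ext x
    rw [hsupp, and_iff_right hv, Finset.mem_union]
    refine or_congr_right ⟨?_, fun hx => ⟨⟨h, hlt⟩, hbest, hx⟩⟩
    rintro ⟨h', hbest', hx⟩
    exact hbest.unique hbest' ▸ hx

end

end VectorConnectivity

/-! ### The greedy choice for a given root -/

namespace VectorConnectivity

open SimpleGraph RAM

/-- Treat all blocks, proceeding towards the root in variable `10`. -/
def roundsStmt : Stmt := .loop 11 (.loop 12 chooseStmt)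

/-- Vector `3` becomes a minimum `RootedSolution` for the root in variable `10`. -/
def greedyStmt : Stmt := .seq (.seq (.vec 3 (.num 0)) roundsStmt)
  (.vec 3 (.or (.get1 3 0) (.eq (.idx 0) (.idx 10))))

variable {n : ℕ} {G : SimpleGraph (Fin n)} {F : Set (Fin n)} {r : Fin n → ℕ} {σ τ : Mem n}
  {ρ v x : Fin n} {S X : Finset (Fin n)} {d j : ℕ}

/-- The vertices treated before vertex `j` in round `d` when the root is `ρ`. -/
def treated (G : SimpleGraph (Fin n)) (ρ : Fin n) (d j : ℕ) : Set (Fin n) :=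
  {x | (G.Reachable ρ x ∧ x ≠ ρ) ∧ (n < G.dist ρ x + d + 1 ∨
    (G.dist ρ x + d + 1 = n ∧ ∃ u, Sib G ρ x u ∧ (u : ℕ) < j))}

lemma treated_zero_zero : treated G ρ 0 0 = ∅ := by
  refine Set.eq_empty_of_forall_notMem ?_
  rintro x ⟨⟨hx, -⟩, h | ⟨-, u, -, hu⟩⟩
  · have := dist_lt_of_reachable hx
    rw [Fintype.card_fin] at this
    omega
  · omega

lemma treated_self_zero : x ∈ treated G ρ n 0 ↔ G.Reachable ρ x ∧ x ≠ ρ := by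
  refine and_iff_left_of_imp fun hx => .inl ?_
  have := hx.1.pos_dist_of_ne hx.2.symm
  omega

lemma treated_succ_zero : treated G ρ (d + 1) 0 = treated G ρ d n := by
  ext x
  refine and_congr_right fun _ => ⟨?_, ?_⟩
  · rintro (h | ⟨-, u, -, hu⟩)
    · obtain h | h : n < G.dist ρ x + d + 1 ∨ G.dist ρ x + d + 1 = n := by omega
      exacts [.inl h, .inr ⟨h, x, .inl rfl, x.2⟩]
    · omega
  · rintro (h | ⟨h, -⟩) <;> exact .inl (by omega)

lemma mem_treated_succ : x ∈ treated G ρ d (v + 1) ↔ x ∈ treated G ρ d v ∨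
    ((G.Reachable ρ x ∧ x ≠ ρ) ∧ G.dist ρ x + d + 1 = n ∧ Sib G ρ x v) := by
  have hlt : (∃ u, Sib G ρ x u ∧ (u : ℕ) < v + 1) ↔
      (∃ u, Sib G ρ x u ∧ (u : ℕ) < v) ∨ Sib G ρ x v := by
    simp only [Nat.lt_succ_iff_lt_or_eq, and_or_left, exists_or, ← Fin.ext_iff, exists_eq_right]
  simp only [treated, Set.mem_ofPred_eq, hlt, and_or_left, or_assoc]

lemma IsBlockGraph.treated_succ_of_not_isActive (hG : IsBlockGraph G)
    (h : ¬ IsActive G ρ v d) : treated G ρ d (v + 1) = treated G ρ d v := by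
  ext x
  rw [mem_treated_succ, or_iff_left_of_imp]
  rintro ⟨⟨hx, hxρ⟩, hd, hxv⟩
  have hfirst : ¬ ∀ u < v, ¬ Sib G ρ v u := fun hfirst =>
    h ⟨hxv.reachable hx, hxv.ne hx hxρ, by rw [hxv.dist_eq]; exact hd, hfirst⟩
  push Not at hfirst
  obtain ⟨u, huv, hu⟩ := hfirst
  exact ⟨⟨hx, hxρ⟩, .inr ⟨hd, u, hG.sib_trans (hxv.reachable hx) hxv.symm hu, huv⟩⟩

lemma IsActive.mem_treated_succ (h : IsActive G ρ v d) :
    x ∈ treated G ρ d (v + 1) ↔ x ∈ treated G ρ d v ∨ Sib G ρ v x := by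
  rw [VectorConnectivity.mem_treated_succ]
  refine or_congr_right ⟨fun hx => hx.2.2.symm, fun hx => ?_⟩
  exact ⟨⟨hx.reachable h.1, hx.ne h.1 h.2.1⟩, by rw [hx.dist_eq]; exact h.2.2.1, hx.symm⟩

/-- Every rooted solution can be replaced by one that is not larger and meets `D` in `S`. -/
def Extendable (G : SimpleGraph (Fin n)) (ρ : Fin n) (F : Set (Fin n)) (r : Fin n → ℕ)
    (D : Set (Fin n)) (S : Finset (Fin n)) : Prop :=
  ∀ T₀, RootedSolution G ρ F r T₀ →
    ∃ T, RootedSolution G ρ F r T ∧ T.card ≤ T₀.card ∧ ∀ x, x ∈ S ↔ x ∈ T ∧ x ∈ D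

lemma Extendable.union (hG : IsBlockGraph G) (h : Extendable G ρ F r (treated G ρ d v) S)
    (hv : IsActive G ρ v d) (hX : (blockProblem G ρ F r S v).IsOptimal X) :
    Extendable G ρ F r (treated G ρ d (v + 1)) (S ∪ X) := by
  intro T₀ hT₀
  obtain ⟨T, hT, hcard, hS⟩ := h T₀ hT₀
  have hd := hv.2.2.1
  obtain ⟨T', hT', hcard', hS'⟩ := hG.exchange (D := treated G ρ d v) hv.1 hv.2.1
    (fun x hx hlt => ⟨⟨hx, by rintro rfl; simp at hlt⟩, .inl (by omega)⟩)
    (by rintro x ⟨-, h | h⟩ <;> omega)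
    (by
      rintro x ⟨⟨hx, -⟩, h | ⟨-, u, hu, hlt⟩⟩ hvx
      · have := hvx.dist_eq; omega
      · exact hv.2.2.2 u hlt (hG.sib_trans hx hvx.symm hu))
    hS hT hX
  exact ⟨T', hT', hcard'.trans hcard, fun x => by
    rw [Finset.mem_union, hS', hv.mem_treated_succ]⟩

lemma rootedSolution_reachable : ∃ T, RootedSolution G ρ F r T := by
  classical
  exact ⟨Finset.univ.filter fun x => G.Reachable ρ x, by simp, by simp,
    fun v hv hv' => absurd (by simpa using hv) hv'⟩

/-- What is known in round `d` before vertex `j` is treated, if the greedy choice starts in `σ`. -/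
structure GreedyUpTo (G : SimpleGraph (Fin n)) (ρ : Fin n) (F : Set (Fin n)) (r : Fin n → ℕ)
    (σ : Mem n) (d j : ℕ) (τ : Mem n) : Prop where
  data : Data G F r τ
  one : τ.one 1 = σ.one 1
  extendable : Extendable G ρ F r (treated G ρ d j) (support τ 3)

lemma GreedyUpTo.succ {ρ : ℕ → Fin n} (hG : IsBlockGraph G)
    (h : GreedyUpTo G (ρ 10) F r σ (ρ 11) (ρ 12) τ) :
    GreedyUpTo G (ρ 10) F r σ (ρ 11) (ρ 12 + 1) (chooseStmt.exec ρ τ) := by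
  obtain ⟨hdata, hone, hinactive, hactive⟩ := h.data.exec_chooseStmt (ρ := ρ)
  refine ⟨hdata, hone.trans h.one, ?_⟩
  by_cases hv : IsActive G (ρ 10) (ρ 12) (ρ 11)
  · obtain ⟨X, hX, hsupp⟩ := hactive hv
    exact hsupp ▸ h.extendable.union hG hv hX
  · rw [hG.treated_succ_of_not_isActive hv, hinactive hv]
    exact h.extendable

lemma Data.exec_roundsStmt (hG : IsBlockGraph G) (hσ : Data G F r σ) (h3 : σ.one 3 = 0)
    (ρ : ℕ → Fin n) : GreedyUpTo G (ρ 10) F r σ n 0 (roundsStmt.exec ρ σ) := by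
  refine fold_induction (fun d => GreedyUpTo G (ρ 10) F r σ d 0) ⟨hσ, rfl, fun T hT => ?_⟩
    fun d hd τ h => ?_
  · exact ⟨T, hT, le_rfl, fun x => by simp [treated_zero_zero, mem_support, h3]⟩
  · have hround := fold_induction (f := fun j hj τ => chooseStmt.exec
      (Function.update (Function.update ρ 11 ⟨d, hd⟩) 12 ⟨j, hj⟩) τ)
      (GreedyUpTo G (ρ 10) F r σ d) h fun j hj τ h =>
        h.succ (ρ := Function.update (Function.update ρ 11 ⟨d, hd⟩) 12 ⟨j, hj⟩) hG
    exact ⟨hround.data, hround.one, treated_succ_zero ▸ hround.extendable⟩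

lemma Data.exec_greedyStmt (hG : IsBlockGraph G) (hσ : Data G F r σ) (ρ : ℕ → Fin n) :
    Data G F r (greedyStmt.exec ρ σ) ∧ (greedyStmt.exec ρ σ).one 1 = σ.one 1 ∧
      RootedSolution G (ρ 10) F r (support (greedyStmt.exec ρ σ) 3) ∧
      ∀ T, RootedSolution G (ρ 10) F r T → (support (greedyStmt.exec ρ σ) 3).card ≤ T.card := by
  classical
  have hinit : Data G F r ((Stmt.vec 3 (.num 0)).exec ρ σ) := hσ.congr rfl rfl rfl
  obtain ⟨hdata, hone, hext⟩ := hinit.exec_roundsStmt hG (by ext; simp [Stmt.exec]) ρ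
  rw [greedyStmt, Stmt.exec, Stmt.exec]
  set τ := roundsStmt.exec ρ ((Stmt.vec 3 (.num 0)).exec ρ σ)
  set τ' := (Stmt.vec 3 (.or (.get1 3 0) (.eq (.idx 0) (.idx 10)))).exec ρ τ with hτ'
  have hmem : ∀ x, x ∈ support τ' 3 ↔ x ∈ support τ 3 ∨ x = ρ 10 := fun x => by
    simp only [mem_support, hτ', Stmt.exec, Function.update_self]
    change Expr.IsTrue _ _ _ ↔ _
    simp [Expr.true_get1, Fin.ext_iff]
  have hmin : ∀ T₀, RootedSolution G (ρ 10) F r T₀ →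
      RootedSolution G (ρ 10) F r (support τ' 3) ∧ (support τ' 3).card ≤ T₀.card := by
    intro T₀ hT₀
    obtain ⟨T, hT, hcard, hS⟩ := hext T₀ hT₀
    have heq : support τ' 3 = T := by
      ext x
      rw [hmem, hS, treated_self_zero]
      refine ⟨?_, fun h => ?_⟩
      · rintro (h | rfl)
        exacts [h.1, hT.root_mem]
      · by_cases hx : x = ρ 10
        exacts [.inr hx, .inl ⟨h, hT.reachable x h, hx⟩]
    exact heq ▸ ⟨hT, hcard⟩
  obtain ⟨T, hT⟩ := rootedSolution_reachable (G := G) (F := F) (r := r) (ρ := ρ 10)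
  exact ⟨hdata.congr rfl rfl rfl, hone.trans rfl, (hmin T hT).1, fun T₀ h => (hmin T₀ h).2⟩

end VectorConnectivity

/-! ### Combining the roots -/

namespace VectorConnectivity

open SimpleGraph

section

variable {V : Type*} [Fintype V] {G : SimpleGraph V} {ρ v : V} {F : Set V} {r : V → ℕ}
  {S T U : Finset V}

lemma dirs_congr {S T : Set V} (h : ∀ x, G.Reachable v x → (x ∈ S ↔ x ∈ T)) :
    dirs G v S = dirs G v T := by
  ext x
  rw [mem_dirs, mem_dirs]
  exact exists_congr fun w => and_congr_left fun hw => h w (hw.btw.left.trans hw.btw.right)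

lemma FeasibleOn.congr (hS : FeasibleOn G ρ F r S)
    (h : ∀ x, G.Reachable ρ x → (x ∈ S ↔ x ∈ T)) : FeasibleOn G ρ F r T := by
  intro v hv hvT
  rw [← dirs_congr (S := (S : Set V) ∪ F) fun x hx => by simp [h x (hv.trans hx)]]
  exact hS v hv fun hvS => hvT ((h v hv).1 hvS)

lemma FeasibleOn.of_reachable (hS : FeasibleOn G ρ F r S) (h : G.Reachable ρ v) :
    FeasibleOn G v F r S := fun u hu huS => hS u (h.trans hu) huS

lemma IsBlockGraph.isFreeVCSet_iff (hG : IsBlockGraph G) {F : Finset V} :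
    IsFreeVCSet G F r S ↔ ∀ ρ, FeasibleOn G ρ F r S :=
  ⟨fun h _ v _ hvS => hG.isLinked_iff.1 (h v hvS),
    fun h v hvS => hG.isLinked_iff.2 (h v v .rfl hvS)⟩

open Classical in
/-- On the component of `v` the set `S` meets the requirements, and it is not larger there
than `T`. -/
def BetterOn (G : SimpleGraph V) (v : V) (F : Set V) (r : V → ℕ) (S T : Finset V) : Prop :=
  FeasibleOn G v F r S ∧ (S.filter (G.Reachable v)).card ≤ (T.filter (G.Reachable v)).card

lemma BetterOn.trans (h : BetterOn G v F r S T) (h' : BetterOn G v F r T U) :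
    BetterOn G v F r S U := ⟨h.1, h.2.trans h'.2⟩

lemma BetterOn.congr (h : BetterOn G v F r S T)
    (hS : ∀ x, G.Reachable v x → (x ∈ S ↔ x ∈ U)) : BetterOn G v F r U T := by
  classical
  refine ⟨h.1.congr hS, h.2.trans' (le_of_eq ?_)⟩
  congr 1
  ext x
  simp only [Finset.mem_filter]
  exact and_congr_left fun hx => (hS x hx).symm

lemma BetterOn.of_reachable (h : BetterOn G ρ F r S T) (hv : G.Reachable ρ v) :
    BetterOn G v F r S T := by
  classical
  have hfilter (S : Finset V) : S.filter (G.Reachable v) = S.filter (G.Reachable ρ) :=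
    Finset.filter_congr fun _ _ => ⟨hv.trans, hv.symm.trans⟩
  refine ⟨h.1.of_reachable hv, ?_⟩
  rw [hfilter, hfilter]
  exact h.2

lemma FeasibleOn.betterOn_rootedSolution (hT : FeasibleOn G ρ F r T) (hρ : ρ ∈ T)
    (hU : RootedSolution G ρ F r U) (hmin : ∀ T, RootedSolution G ρ F r T → U.card ≤ T.card) :
    BetterOn G ρ F r U T := by
  classical
  refine ⟨hU.feasible, ?_⟩
  rw [Finset.filter_true_of_mem hU.reachable]
  exact hmin _ ⟨by simp [hρ], by simp, hT.congr fun x hx => by simp [hx]⟩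

open Classical in
/-- The better of the sets `S` and `U` on the component of `ρ`, and `S` elsewhere. -/
noncomputable def improve (G : SimpleGraph V) (ρ : V) (F : Set V) (r : V → ℕ) (S U : Finset V) :
    Finset V :=
  Finset.univ.filter fun x =>
    if G.Reachable ρ x ∧ ¬ BetterOn G ρ F r S U then x ∈ U else x ∈ S

lemma betterOn_improve_of_not_reachable (h : BetterOn G v F r S T) (hv : ¬ G.Reachable ρ v) :
    BetterOn G v F r (improve G ρ F r S U) T :=
  h.congr fun x hx => by simp [improve, show ¬ G.Reachable ρ x from fun h => hv (h.trans hx.symm)]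

lemma FeasibleOn.betterOn_improve_right (hU : FeasibleOn G ρ F r U) :
    BetterOn G ρ F r (improve G ρ F r S U) U := by
  by_cases h : BetterOn G ρ F r S U
  · exact h.congr fun x _ => by simp [improve, h]
  · exact BetterOn.congr ⟨hU, le_rfl⟩ fun x hx => by simp [improve, h, hx]

lemma BetterOn.improve_left (h : BetterOn G ρ F r S T) (hU : FeasibleOn G ρ F r U) :
    BetterOn G ρ F r (improve G ρ F r S U) T := by
  by_cases hSU : BetterOn G ρ F r S U
  · exact h.congr fun x _ => by simp [improve, hSU]
  · exact hU.betterOn_improve_right.trans ⟨hU, (le_of_not_ge fun hle => hSU ⟨h.1, hle⟩).trans h.2⟩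

open Classical in
lemma card_le_card_of_forall_component
    (h : ∀ v, (S.filter (G.Reachable v)).card ≤ (T.filter (G.Reachable v)).card) :
    S.card ≤ T.card := by
  have hsum (S : Finset V) := Finset.card_eq_sum_card_fiberwise (s := S) (t := Finset.univ)
    (f := G.connectedComponentMk) fun _ _ => Finset.mem_coe.2 (Finset.mem_univ _)
  rw [hsum S, hsum T]
  refine Finset.sum_le_sum fun c _ => ?_
  obtain ⟨v, rfl⟩ : ∃ v, G.connectedComponentMk v = c := c.exists_rep
  simpa only [ConnectedComponent.eq, reachable_comm] using h v

end

variable {n : ℕ} {G : SimpleGraph (Fin n)} {r : Fin n → ℕ} {S U : Finset (Fin n)}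

/-- On every component, `S` is at least as good as the sets that meet the requirements there and
avoid the component or contain a vertex less than `k` of it. -/
def BestUpTo (G : SimpleGraph (Fin n)) (F : Set (Fin n)) (r : Fin n → ℕ) (k : ℕ)
    (S : Finset (Fin n)) : Prop :=
  ∀ v T, FeasibleOn G v F r T →
    ((∃ x ∈ T, G.Reachable v x) → ∃ x ∈ T, G.Reachable v x ∧ (x : ℕ) < k) → BetterOn G v F r S T

lemma bestUpTo_zero {F : Set (Fin n)} : BestUpTo G F r 0 ∅ := by
  intro v T hT hk
  refine ⟨hT.congr fun x hx => ⟨fun h => ?_, by simp⟩, by simp⟩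
  simpa using hk ⟨x, h, hx⟩

lemma BestUpTo.succ {ρ : Fin n} {F : Set (Fin n)} (hS : BestUpTo G F r ρ S)
    (hU : RootedSolution G ρ F r U) (hmin : ∀ T, RootedSolution G ρ F r T → U.card ≤ T.card) :
    BestUpTo G F r (ρ + 1) (improve G ρ F r S U) := by
  intro v T hT hk
  have hold (h : ¬ (ρ ∈ T ∧ G.Reachable ρ v)) : BetterOn G v F r S T := by
    refine hS v T hT fun hex => ?_
    obtain ⟨x, hx, hvx, hlt⟩ := hk hex
    have hne : (x : ℕ) ≠ ρ := fun heq => h (Fin.ext heq ▸ ⟨hx, hvx.symm⟩)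
    exact ⟨x, hx, hvx, by omega⟩
  by_cases hv : G.Reachable ρ v
  · refine BetterOn.of_reachable ?_ hv
    by_cases hρT : ρ ∈ T
    · exact hU.feasible.betterOn_improve_right.trans
        ((hT.of_reachable hv.symm).betterOn_rootedSolution hρT hU hmin)
    · exact ((hold fun h => hρT h.1).of_reachable hv.symm).improve_left hU.feasible
  · exact betterOn_improve_of_not_reachable (hold fun h => hv h.2) hv

lemma IsBlockGraph.solvesFreeVecCon (hG : IsBlockGraph G) {F : Finset (Fin n)}
    (hS : BestUpTo G F r n S) : SolvesFreeVecCon G F r S := by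
  have hbetter : ∀ T, IsFreeVCSet G F r T → ∀ v, BetterOn G v F r S T := fun T hT v =>
    hS v T (hG.isFreeVCSet_iff.1 hT v) fun ⟨x, hx, hvx⟩ => ⟨x, hx, hvx, x.2⟩
  refine ⟨hG.isFreeVCSet_iff.2 fun v => (hbetter Finset.univ (fun v hv => ?_) v).1,
    fun T hT => card_le_card_of_forall_component fun v => (hbetter T hT v).2⟩
  exact absurd (Finset.mem_univ v) hv

end VectorConnectivity

/-! ### The algorithm -/

namespace VectorConnectivity

open SimpleGraph RAM

/-- The formula for `FirstStep`. -/
def firstStepE (v x w : ℕ) : Expr :=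
  .or (.and (.eq (.idx x) (.idx v)) (.eq (.idx w) (.idx v))) (.and (.get2 0 v x) (btwE v x w))

/-- The formula saying that vector `1` is `FeasibleOn` the component of variable `10`. -/
def feasibleE : Expr :=
  .all 1 (.or (.not (.get2 1 10 1)) (.or (.get1 1 1) (.le (.get1 0 1) (.count 2 (.ex 3
    (.and (.or (.get1 1 3) (.get1 2 3)) (firstStepE 1 2 3)))))))

/-- The formula saying that vector `1` is `BetterOn` the component of variable `10` than
vector `3`. -/
def betterE : Expr :=
  .and feasibleE (.le (.count 1 (.and (.get1 1 1) (.get2 1 10 1)))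
    (.count 1 (.and (.get1 3 1) (.get2 1 10 1))))

/-- Vector `1` becomes the result of `improve` with vector `3` for the root in variable `10`. -/
def improveStmt : Stmt :=
  .vec 1 (.ite (.and (.get2 1 10 0) (.not betterE)) (.get1 3 0) (.get1 1 0))

/-- Vector `1` becomes a solution of the FreeVecCon instance if it is the zero vector. -/
def solveStmt : Stmt := .seq distances (.loop 10 (.seq greedyStmt improveStmt))

variable {n : ℕ} {G : SimpleGraph (Fin n)} {F : Set (Fin n)} {r : Fin n → ℕ} {σ τ : Mem n}
  {ρ : ℕ → Fin n}

lemma Data.true_firstStepE (hσ : Data G F r σ) {v x w : ℕ} :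
    Expr.IsTrue σ ρ (firstStepE v x w) ↔ FirstStep G (ρ v) (ρ x) (ρ w) := by
  simp [firstStepE, FirstStep, Expr.true_get2, hσ.adj, hσ.true_btwE, Fin.ext_iff]

lemma Data.true_feasibleE (hσ : Data G F r σ) :
    Expr.IsTrue σ ρ feasibleE ↔ FeasibleOn G (ρ 10) F r (support σ 1) := by
  classical
  simp [feasibleE, FeasibleOn, Expr.true_get1, Expr.true_get2, hσ.true_firstStepE, hσ.reach,
    hσ.free, hσ.req, dirs, mem_support, imp_iff_not_or]

lemma Data.true_betterE (hσ : Data G F r σ) :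
    Expr.IsTrue σ ρ betterE ↔ BetterOn G (ρ 10) F r (support σ 1) (support σ 3) := by
  classical
  rw [betterE, Expr.true_and, hσ.true_feasibleE, Expr.true_le, Expr.eval_count, Expr.eval_count]
  refine and_congr_right fun _ => ?_
  congr! 2 <;> ext x <;> simp [Expr.true_get1, Expr.true_get2, hσ.reach, mem_support]

lemma Data.support_improveStmt (hσ : Data G F r σ) :
    support (improveStmt.exec ρ σ) 1 = improve G (ρ 10) F r (support σ 1) (support σ 3) := by
  classical
  ext x
  simp only [mem_support, improveStmt, Stmt.exec, improve, Function.update_self, Expr.eval_ite,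
    Finset.mem_filter_univ, Expr.true_and, Expr.true_not, Expr.true_get2, hσ.true_betterE, hσ.reach]
  split_ifs <;> simp_all

lemma exec_solveStmt (hG : IsBlockGraph G) (ρ : ℕ → Fin n) (hreq : σ.one 0 = r)
    (hfree : ∀ v, σ.one 2 v ≠ 0 ↔ v ∈ F) (hadj : ∀ u v, σ.two 0 u v ≠ 0 ↔ G.Adj u v)
    (hdist : ∀ u v, σ.two 2 u v = 0) (hout : σ.one 1 = 0) :
    BestUpTo G F r n (support (solveStmt.exec ρ σ) 1) := by
  have hinit := exec_distances ρ hadj hdist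
  suffices Data G F r (solveStmt.exec ρ σ) ∧ BestUpTo G F r n (support (solveStmt.exec ρ σ) 1)
    from this.2
  refine fold_induction (fun k τ => Data G F r τ ∧ BestUpTo G F r k (support τ 1))
    ⟨hinit.data hreq hfree hadj, ?_⟩ fun k hk τ ⟨hdata, hbest⟩ => ?_
  · have hempty : support (distances.exec ρ σ) 1 = ∅ := by
      ext x
      simp [mem_support, hinit.one, hout]
    exact hempty ▸ bestUpTo_zero
  · obtain ⟨hdata, hone, hsol, hmin⟩ := hdata.exec_greedyStmt hG (Function.update ρ 10 ⟨k, hk⟩)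
    refine ⟨hdata.congr rfl rfl rfl, ?_⟩
    rw [Stmt.exec, hdata.support_improveStmt, support, hone]
    exact hbest.succ (ρ := ⟨k, hk⟩) hsol hmin

lemma ofStore_freeVecConInput_one_zero (F : Finset (Fin n)) :
    (Mem.ofStore n (freeVecConInput G F r)).one 0 = r := by
  ext v
  simp [Mem.ofStore, freeVecConInput]

lemma ofStore_freeVecConInput_one_two (F : Finset (Fin n)) {v : Fin n} :
    (Mem.ofStore n (freeVecConInput G F r)).one 2 v ≠ 0 ↔ v ∈ F := by
  simp [Mem.ofStore, freeVecConInput, Fin.val_inj]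

lemma ofStore_freeVecConInput_two_zero (F : Finset (Fin n)) {u v : Fin n} :
    (Mem.ofStore n (freeVecConInput G F r)).two 0 u v ≠ 0 ↔ G.Adj u v := by
  suffices (∃ u' v' : Fin n, (u * n + v : ℕ) = u' * n + v' ∧ G.Adj u' v') ↔ G.Adj u v by
    simpa [Mem.ofStore, freeVecConInput]
  simp [row_position]

lemma eval_mono (q : Polynomial ℕ) : Monotone fun n => q.eval n := fun m n h => by
  simp only [Polynomial.eval_eq_sum_range]
  gcongr

lemma le_instanceLength : n ≤ instanceLength r := by
  rw [instanceLength]; omega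

theorem exists_program_freeVecCon : ∃ (p : RAM.Prog) (q : Polynomial ℕ),
    ∀ (n : ℕ) (G : SimpleGraph (Fin n)) (F : Finset (Fin n)) (r : Fin n → ℕ), IsBlockGraph G →
      ∃ (s : RAM.Store) (t : ℕ), RAM.Runs p (freeVecConInput G F r) s t ∧
        t ≤ q.eval (instanceLength r) ∧ SolvesFreeVecCon G F r (outputSet n s) := by
  obtain ⟨q, hq⟩ := exists_polynomial_does_program solveStmt
  refine ⟨solveStmt.program, q, fun n G F r hG => ?_⟩
  obtain ⟨s, t, hruns, ht, hout⟩ := hq n (freeVecConInput G F r) rfl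
    fun x hx => by simp [freeVecConInput, hx]
  refine ⟨s, t, hruns, ht.trans (eval_mono q le_instanceLength), ?_⟩
  obtain rfl | hn := n.eq_zero_or_pos
  · exact ⟨fun v => v.elim0, fun T _ => by simp [Subsingleton.elim (outputSet 0 s) T]⟩
  have hbest := exec_solveStmt (F := F) (r := r) hG (fun _ => ⟨0, hn⟩)
    (ofStore_freeVecConInput_one_zero F) (fun _ => ofStore_freeVecConInput_one_two F)
    (fun _ _ => ofStore_freeVecConInput_two_zero F) (fun _ _ => rfl) rfl
  convert hG.solvesFreeVecCon hbest
  ext v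
  simp [outputSet, mem_support, hout ⟨0, hn⟩ v rfl]

lemma vecConInput_eq : vecConInput G r = freeVecConInput G ∅ r := by
  simp [vecConInput, freeVecConInput]

lemma solvesFreeVecCon_empty {S : Finset (Fin n)} :
    SolvesFreeVecCon G ∅ r S ↔ SolvesVecCon G r S := by
  simp [SolvesFreeVecCon, SolvesVecCon, IsFreeVCSet, IsVCSet]

end VectorConnectivity

theorem mainTheorem4 :
    (∃ (p : RAM.Prog) (q : Polynomial ℕ),
      ∀ (n : ℕ) (G : SimpleGraph (Fin n)) (r : Fin n → ℕ),
        VectorConnectivity.IsBlockGraph G →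
          ∃ (s : RAM.Store) (t : ℕ),
            RAM.Runs p (VectorConnectivity.vecConInput G r) s t ∧
            t ≤ q.eval (VectorConnectivity.instanceLength r) ∧
            VectorConnectivity.SolvesVecCon G r (VectorConnectivity.outputSet n s)) ∧
    (∃ (p : RAM.Prog) (q : Polynomial ℕ),
      ∀ (n : ℕ) (G : SimpleGraph (Fin n)) (F : Finset (Fin n)) (r : Fin n → ℕ),
        VectorConnectivity.IsBlockGraph G →
          ∃ (s : RAM.Store) (t : ℕ),
            RAM.Runs p (VectorConnectivity.freeVecConInput G F r) s t ∧
            t ≤ q.eval (VectorConnectivity.instanceLength r) ∧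
            VectorConnectivity.SolvesFreeVecCon G F r (VectorConnectivity.outputSet n s)) := by
  obtain ⟨p, q, h⟩ := VectorConnectivity.exists_program_freeVecCon
  refine ⟨⟨p, q, fun n G r hG => ?_⟩, p, q, h⟩
  obtain ⟨s, t, hruns, hle, hsolves⟩ := h n G ∅ r hG
  rw [VectorConnectivity.vecConInput_eq]
  exact ⟨s, t, hruns, hle, VectorConnectivity.solvesFreeVecCon_empty.1 hsolves⟩
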